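/- **Games.** A game $A$ is a partially ordered set of moves $(M_A,\le_A)$ in which every move has finitely many predecessors, with a polarity $\lambda_A:M_A\to\{-1,+1\}$ ($+1$: Proponent, $-1$: Opponent). $A^*$ is $A$ with inverted polarities, $A\otimes B$ is the disjoint union, $A\multimap B=A^*\otimes B$, and $A\varolessthan B$ ("$A$ before $B$") is the disjoint union in which moreover every move of $A$ is below every move of $B$. $I$ is the empty game; $O$, resp. $P$, is the game with exactly one Opponent, resp. Proponent, move. A game is finite filiform if it is finite and totally ordered. A *cyclic strategy* on $A$ is a reflexive transitive relation $\sigma$ on $M_A$ such that $m\mathrel\sigma n$ and $m\ne n$ imply $\lambda_A(m)=-1$ and $\lambda_A(n)=+1$. It is a *strategy* if it is a partial order and the transitive closure of $\sigma\cup{\le_A}$ is a partial order. The composite of cyclic strategies $\sigma$ on $A\multimap B$ and $\tau$ on $B\multimap C$ is the restriction to $M_A\uplus M_C$ of the transitive closure of $\sigma\cup\tau$ on $M_A\uplus M_B\uplus M_C$; the identity on $A\multimap A$ relates the two copies of each move, from the Opponent copy to the Proponent copy. $\mathbf{Games}$ is the smallest category, with this composition and these identities, whose objects are the finite filiform games and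 whose morphisms $A\to B$ include all strategies on $A\multimap B$. **Logic.** Fix a first-order language $\mathcal L$ with countably infinitely many variables, obtained from an arbitrary one by adding function symbols $\top,\bot$ (nullary) and $\wedge,\vee$ (binary), a unary proposition symbol $I$ and nullary proposition symbols $\top,\bot$, and by closing the proposition symbols under formal conjunction and disjunction (if $P(\vec s)$ and $Q(\vec t)$ are propositions, so are $P(\vec s)\wedge Q(\vec t)$ and $P(\vec s)\vee Q(\vec t)$). Formulas are $A::=P(t_1,\dots,t_n)\mid\forall x\,A\mid\exists x\,A$, up to renaming of bound variables. A set of axioms is a reflexive and transitive set $\mathrm{Ax}$ of pairs of propositions, closed under substitution. The rules for sequents $A\vdash B$ are: $P\vdash Q$ for $(P,Q)\in\mathrm{Ax}$; from $A[t/x]\vdash B$ infer $\forall x A\vdash B$; from $A\vdash B$ infer $A\vdash\forall x B$ ($x$ not free in $A$); from $A\vdash B$ infer $\exists x A\vdash B$ ($x$ not free in $B$); from $A\vdash B[t/x]$ infer $A\vdash\exists x B$; and cut. Let $\mathrm{Ax}_0$ be the smallest reflexive transitive set of pairs of propositions such that, for all propositions and all terms $s,t$: * $(P,\top),(\bot,P)\in\mathrm{Ax}_0$;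 * if $(P,P_1)\in\mathrm{Ax}_0$ and $(P,P_2)\in\mathrm{Ax}_0$ then $(P,P_1\wedge P_2)\in\mathrm{Ax}_0$; if $(P,P_1)\in\mathrm{Ax}_0$ or $(P,P_2)\in\mathrm{Ax}_0$ then $(P,P_1\vee P_2)\in\mathrm{Ax}_0$; * if $(P_1,P)\in\mathrm{Ax}_0$ or $(P_2,P)\in\mathrm{Ax}_0$ then $(P_1\wedge P_2,P)\in\mathrm{Ax}_0$; if $(P_1,P)\in\mathrm{Ax}_0$ and $(P_2,P)\in\mathrm{Ax}_0$ then $(P_1\vee P_2,P)\in\mathrm{Ax}_0$; * $I(\top)$, $I(\bot)$, $I(s\wedge t)$, $I(s\vee t)$ are equivalent (related in both directions) to $\top$, $\bot$, $I(s)\wedge I(t)$, $I(s)\vee I(t)$ respectively. **Interpretation.** $[\![P(\vec t)]\!]=I$, $[\![\forall x A]\!]=O\varolessthan[\![A]\!]$, $[\![\exists x A]\!]=P\varolessthan[\![A]\!]$; so moves are quantifier occurrences. A cut-free proof $\pi$ of $A\vdash B$ (with pairwise distinct variables chosen for the rules $\forall$-R and $\exists$-L, not occurring free below the rule) is interpreted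 as the following strategy $[\![\pi]\!]$ on $[\![A]\!]\multimap[\![B]\!]$: for $m\neq n$, $m\le n$ holds iff $n$ is introduced by a rule $\forall$-L or $\exists$-R with a witness term $t$, $m$ is introduced by a rule $\forall$-R or $\exists$-L with variable $x$, this rule is below the rule introducing $n$, and $x$ is free in $t$. **Theorem.** $\mathrm{Ax}_0$ is a set of axioms (reflexive, transitive, closed under substitution), and it is coherent: the sequent $\top\vdash\bot$ has no proof (even with cuts). For every set of axioms $\mathrm{Ax}\supseteq\mathrm{Ax}_0$, in particular for $\mathrm{Ax}_0$ itself, every morphism $\sigma:A\to B$ of $\mathbf{Games}$ is definable: there are formulas $F,G$ with $[\![F]\!]\cong A$ and $[\![G]\!]\cong B$, and a cut-free proof $\pi$ of $F\vdash G$ over $\mathrm{Ax}$ such that, along these isomorphisms, $\sigma=[\![\pi]\!]$. -/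

import Mathlib

universe u v w

/-! ## Games and strategies -/

/-- A game: moves with a polarity (`1` for Proponent, `-1` for Opponent) and a causality partial
order in which every move has finitely many predecessors. -/
structure Game : Type (u + 1) where
  Move : Type u
  [order : PartialOrder Move]
  pol : Move → ℤˣ
  finite_down : ∀ m : Move, {n : Move | n ≤ m}.Finite

namespace Game

attribute [instance] Game.order

/-- The empty game. -/
def empty : Game.{0} where
  Move := Empty
  pol := Empty.elim
  finite_down m := m.elim

/-- The game with exactly one move, of polarity `s`. -/
def single (s : ℤˣ) : Game.{0} where
  Move := Unit
  pol _ := s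
  finite_down _ := Set.toFinite _

/-- The game `O` with only one Opponent move. -/
def O : Game.{0} := single (-1)

/-- The game `P` with only one Proponent move. -/
def P : Game.{0} := single 1

/-- The tensor product: disjoint union of moves, polarities and causality
(Mathlib's order on `α ⊕ β` is the disjoint union of the two orders). -/
def tensor (A B : Game.{u}) : Game.{u} where
  Move := A.Move ⊕ B.Move
  pol := Sum.elim A.pol B.pol
  finite_down := by
    rintro (m | m)
    · refine ((A.finite_down m).image Sum.inl).subset ?_
      rintro (n | n) h
      · exact ⟨n, Sum.inl_le_inl_iff.1 h, rfl⟩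
      · exact absurd h Sum.not_inr_le_inl
    · refine ((B.finite_down m).image Sum.inr).subset ?_
      rintro (n | n) h
      · exact absurd h Sum.not_inl_le_inr
      · exact ⟨n, Sum.inr_le_inr_iff.1 h, rfl⟩

/-- The opposite game: polarities are inverted. -/
def dual (A : Game.{u}) : Game.{u} where
  Move := A.Move
  pol m := -A.pol m
  finite_down := A.finite_down

/-- The arrow game `A ⊸ B = A* ⊗ B`. -/
def arrow (A B : Game.{u}) : Game.{u} := tensor (dual A) B

/-- The game `A` before `B`: every move of `A` is put below every move of `B`. The game `A` has to
be finite for the result to be well-founded. -/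
def before (A B : Game.{u}) [Finite A.Move] : Game.{u} where
  Move := A.Move ⊕ B.Move
  order :=
    { le := Sum.Lex (· ≤ ·) (· ≤ ·)
      lt := fun x y => Sum.Lex (· ≤ ·) (· ≤ ·) x y ∧ ¬ Sum.Lex (· ≤ ·) (· ≤ ·) y x
      lt_iff_le_not_ge := fun _ _ => Iff.rfl
      le_refl := by rintro (a | a) <;> constructor <;> exact le_rfl
      le_trans := by
        rintro _ _ _ (h | h | _) (h' | h' | _)
        · exact .inl (h.trans h')
        · exact .sep _ _
        · exact .inr (h.trans h')
        · exact .sep _ _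
      le_antisymm := by
        rintro _ _ (h | h | _) (h' | h' | _)
        · exact congrArg _ (h.antisymm h')
        · exact congrArg _ (h.antisymm h') }
  pol := Sum.elim A.pol B.pol
  finite_down := by
    rintro (m | m)
    · refine (Set.finite_range (Sum.inl : A.Move → A.Move ⊕ B.Move)).subset ?_
      rintro _ (h | h | _)
      exact ⟨_, rfl⟩
    · refine ((Set.finite_range (Sum.inl : A.Move → A.Move ⊕ B.Move)).union
        ((B.finite_down m).image Sum.inr)).subset ?_
      rintro _ (h | h | _)
      · exact Or.inr ⟨_, h, rfl⟩
      · exact Or.inl ⟨_, rfl⟩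

/-- Finite filiform games: finitely many moves, totally ordered by causality. -/
structure FiniteFiliform (A : Game.{u}) : Prop where
  finite : Finite A.Move
  total : ∀ m n : A.Move, m ≤ n ∨ n ≤ m

/-- Isomorphisms of games. -/
structure Iso (A : Game.{u}) (B : Game.{v}) where
  toEquiv : A.Move ≃ B.Move
  le_iff : ∀ m n : A.Move, toEquiv m ≤ toEquiv n ↔ m ≤ n
  pol_eq : ∀ m : A.Move, B.pol (toEquiv m) = A.pol m

end Game

/-- A cyclic strategy on a game: a reflexive and transitive relation on its moves relating distinct
moves only from an Opponent move to a Proponent move. -/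
structure CyclicStrategy (A : Game.{u}) where
  rel : A.Move → A.Move → Prop
  refl : ∀ m, rel m m
  trans : ∀ l m n, rel l m → rel m n → rel l n
  polarity : ∀ m n, rel m n → m ≠ n → A.pol m = -1 ∧ A.pol n = 1

/-- A strategy on a game: a partial order on its moves satisfying the polarity condition, and such
that the transitive closure of its union with the causality of the game is a partial order. -/
structure Strategy (A : Game.{u}) extends CyclicStrategy A where
  antisymm : ∀ m n, rel m n → rel n m → m = n
  acyclic : ∀ m n, Relation.TransGen (fun a b => a ≤ b ∨ rel a b) m n →
    Relation.TransGen (fun a b => a ≤ b ∨ rel a b) n m → m = n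

namespace CyclicStrategy

/-- The identity of a game `A`, a cyclic strategy on `A ⊸ A`: each Proponent move of the target is
justified by its copy in the source, each Opponent move of the target justifies its copy in the
source. -/
def id (A : Game.{u}) : CyclicStrategy (A.arrow A) where
  rel := fun (x y : A.Move ⊕ A.Move) => x = y ∨
    (∃ m, A.pol m = 1 ∧ x = Sum.inl m ∧ y = Sum.inr m) ∨
    (∃ m, A.pol m = -1 ∧ x = Sum.inr m ∧ y = Sum.inl m)
  refl _ := Or.inl rfl
  trans := by
    rintro l m n (rfl | ⟨a, ha, rfl, rfl⟩ | ⟨a, ha, rfl, rfl⟩) h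
    · exact h
    · obtain h | ⟨b, hb, h, rfl⟩ | ⟨b, hb, h, rfl⟩ := h
      · exact Or.inr (Or.inl ⟨a, ha, rfl, h.symm⟩)
      · cases h
      · cases h
        rw [ha] at hb
        exact absurd hb (by decide)
    · obtain h | ⟨b, hb, h, rfl⟩ | ⟨b, hb, h, rfl⟩ := h
      · exact Or.inr (Or.inr ⟨a, ha, rfl, h.symm⟩)
      · cases h
        rw [ha] at hb
        exact absurd hb (by decide)
      · cases h
  polarity := by
    rintro m n (rfl | ⟨a, ha, rfl, rfl⟩ | ⟨a, ha, rfl, rfl⟩) hne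
    · exact absurd rfl hne
    · exact ⟨congrArg Neg.neg ha, ha⟩
    · exact ⟨ha, (congrArg Neg.neg ha).trans (neg_neg 1)⟩

variable {A B C : Game.{u}}

/-- The union of two relations on the moves of `A ⊸ B` and of `B ⊸ C`, as a relation on the
disjoint union of the moves of `A`, `B` and `C`. -/
def union (σ : CyclicStrategy (A.arrow B)) (τ : CyclicStrategy (B.arrow C)) :
    A.Move ⊕ (B.Move ⊕ C.Move) → A.Move ⊕ (B.Move ⊕ C.Move) → Prop := fun x y =>
  Relation.Map σ.rel (Sum.map _root_.id Sum.inl) (Sum.map _root_.id Sum.inl) x y ∨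
    Relation.Map τ.rel Sum.inr Sum.inr x y

theorem union_polarity (σ : CyclicStrategy (A.arrow B)) (τ : CyclicStrategy (B.arrow C))
    {x y : A.Move ⊕ (B.Move ⊕ C.Move)} (h : Relation.TransGen (union σ τ) x y) :
    x = y ∨
      ((∀ a, x = Sum.inl a → -A.pol a = -1) ∧ (∀ c, x = Sum.inr (Sum.inr c) → C.pol c = -1) ∧
        (∀ a, y = Sum.inl a → -A.pol a = 1) ∧ (∀ c, y = Sum.inr (Sum.inr c) → C.pol c = 1)) := by
  have step : ∀ x y, union σ τ x y → x = y ∨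
      ((∀ a, x = Sum.inl a → -A.pol a = -1) ∧ (∀ c, x = Sum.inr (Sum.inr c) → C.pol c = -1) ∧
        (∀ a, y = Sum.inl a → -A.pol a = 1) ∧
        (∀ c, y = Sum.inr (Sum.inr c) → C.pol c = 1)) := by
    rintro x y (⟨a, b, h, rfl, rfl⟩ | ⟨a, b, h, rfl, rfl⟩)
    · by_cases hab : a = b
      · exact Or.inl (by rw [hab])
      · have := σ.polarity a b h hab
        right
        rcases a with a | a <;> rcases b with b | b <;>
          refine ⟨?_, ?_, ?_, ?_⟩ <;> intro c hc <;> cases hc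
        all_goals first | exact this.1 | exact this.2
    · by_cases hab : a = b
      · exact Or.inl (by rw [hab])
      · have := τ.polarity a b h hab
        right
        rcases a with a | a <;> rcases b with b | b <;>
          refine ⟨?_, ?_, ?_, ?_⟩ <;> intro c hc <;> cases hc
        all_goals first | exact this.1 | exact this.2
  induction h with
  | single h => exact step _ _ h
  | tail _ h ih =>
    rcases step _ _ h with rfl | h'
    · exact ih
    · rcases ih with rfl | ih
      · exact Or.inr h'
      · exact Or.inr ⟨ih.1, ih.2.1, h'.2.2⟩

/-- The composite `τ ∘ σ`: the transitive closure of the union of the two relations, restricted to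
the moves of `A` and `C`. -/
def comp (σ : CyclicStrategy (A.arrow B)) (τ : CyclicStrategy (B.arrow C)) :
    CyclicStrategy (A.arrow C) where
  rel := fun (x y : A.Move ⊕ C.Move) =>
    Relation.TransGen (union σ τ) (Sum.map _root_.id Sum.inr x) (Sum.map _root_.id Sum.inr y)
  refl := by
    rintro (m | m)
    · exact .single (Or.inl ⟨Sum.inl m, Sum.inl m, σ.refl _, rfl, rfl⟩)
    · exact .single (Or.inr ⟨Sum.inr m, Sum.inr m, τ.refl _, rfl, rfl⟩)
  trans _ _ _ h h' := h.trans h'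
  polarity := by
    rintro m n h hne
    rcases union_polarity σ τ h with h | ⟨h1, h2, h3, h4⟩
    · rcases m with m | m <;> rcases n with n | n <;> cases h <;> exact absurd rfl hne
    · rcases m with m | m <;> rcases n with n | n
      · exact ⟨h1 _ rfl, h3 _ rfl⟩
      · exact ⟨h1 _ rfl, h4 _ rfl⟩
      · exact ⟨h2 _ rfl, h3 _ rfl⟩
      · exact ⟨h2 _ rfl, h4 _ rfl⟩

end CyclicStrategy

/-- The morphisms of the category `Games`: the smallest class of cyclic strategies `A ⊸ B` between
finite filiform games that contains all strategies and identities and is closed under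
composition. -/
inductive GamesHom : ∀ {A B : Game.{u}}, CyclicStrategy (A.arrow B) → Prop
  | ofStrategy {A B : Game.{u}} (hA : A.FiniteFiliform) (hB : B.FiniteFiliform)
      (σ : Strategy (A.arrow B)) : GamesHom σ.toCyclicStrategy
  | id {A : Game.{u}} (hA : A.FiniteFiliform) : GamesHom (CyclicStrategy.id A)
  | comp {A B C : Game.{u}} {σ : CyclicStrategy (A.arrow B)} {τ : CyclicStrategy (B.arrow C)}
      (hσ : GamesHom σ) (hτ : GamesHom τ) : GamesHom (σ.comp τ)

/-! ## Connective-free first-order logic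

The variables are the natural numbers, and binders use de Bruijn indices, so that formulas are
automatically considered up to renaming of bound variables: under a quantifier the variable `0` is
the bound one and the variable `n + 1` is the variable `n` of the outside. -/

/-- A proposition `P(t₁, …, tₙ)`: a proposition symbol applied to terms. -/
structure Proposition (L : FirstOrder.Language.{u, v}) where
  arity : ℕ
  sym : L.Relations arity
  args : Fin arity → L.Term ℕ

/-- Formulas, without connectives. -/
inductive QFormula (L : FirstOrder.Language.{u, v})
  | atom (P : Proposition L) : QFormula L
  | all (A : QFormula L) : QFormula L
  | ex (A : QFormula L) : QFormula L

section Substitution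

variable {L : FirstOrder.Language.{u, v}}

/-- Simultaneous substitution in a proposition. -/
def Proposition.subst (P : Proposition L) (s : ℕ → L.Term ℕ) : Proposition L :=
  ⟨P.arity, P.sym, fun i => (P.args i).subst s⟩

/-- A substitution carried under a quantifier. -/
def liftSubst (s : ℕ → L.Term ℕ) : ℕ → L.Term ℕ
  | 0 => FirstOrder.Language.Term.var 0
  | n + 1 => (s n).relabel Nat.succ

/-- Simultaneous capture-avoiding substitution in a formula. -/
def QFormula.subst : QFormula L → (ℕ → L.Term ℕ) → QFormula L
  | .atom P, s => .atom (P.subst s)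
  | .all A, s => .all (A.subst (liftSubst s))
  | .ex A, s => .ex (A.subst (liftSubst s))

/-- `A[t/x]`, for the body `A` of a quantifier on `x`. -/
def QFormula.inst (A : QFormula L) (t : L.Term ℕ) : QFormula L :=
  A.subst fun | 0 => t | n + 1 => FirstOrder.Language.Term.var n

/-- The formula `A`, seen in the scope of one more variable `0`, not free in it. -/
def QFormula.shift (A : QFormula L) : QFormula L :=
  A.subst fun n => FirstOrder.Language.Term.var (n + 1)

/-- The standing conditions on a set of axioms: it is reflexive, transitive and closed under
substitution. -/
structure IsAxiomSet (Ax : Set (Proposition L × Proposition L)) : Prop where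
  refl : ∀ P, (P, P) ∈ Ax
  trans : ∀ P Q R, (P, Q) ∈ Ax → (Q, R) ∈ Ax → (P, R) ∈ Ax
  subst : ∀ P Q (s : ℕ → L.Term ℕ), (P, Q) ∈ Ax → (P.subst s, Q.subst s) ∈ Ax

/-- Proofs of sequents `A ⊢ B`. In `allR` and `exL` the variable `0` of the premise is the variable
of the quantifier that the rule introduces, and it is not free in the other formula. -/
inductive SeqProof (Ax : Set (Proposition L × Proposition L)) :
    QFormula L → QFormula L → Type (max u v)
  | allL {A B : QFormula L} (t : L.Term ℕ) (π : SeqProof Ax (A.inst t) B) : SeqProof Ax (.all A) B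
  | allR {A B : QFormula L} (π : SeqProof Ax A.shift B) : SeqProof Ax A (.all B)
  | exL {A B : QFormula L} (π : SeqProof Ax A B.shift) : SeqProof Ax (.ex A) B
  | exR {A B : QFormula L} (t : L.Term ℕ) (π : SeqProof Ax A (B.inst t)) : SeqProof Ax A (.ex B)
  | ax {P Q : Proposition L} (h : (P, Q) ∈ Ax) : SeqProof Ax (.atom P) (.atom Q)
  | cut {A B C : QFormula L} (π : SeqProof Ax A B) (π' : SeqProof Ax B C) : SeqProof Ax A C

end Substitution

/-! ## The interpretation of formulas and of cut-free proofs -/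

section Interpretation

variable {L : FirstOrder.Language.{u, v}}

instance (s : ℤˣ) : Finite (Game.single s).Move := inferInstanceAs (Finite Unit)

instance : Finite Game.O.Move := inferInstanceAs (Finite Unit)

instance : Finite Game.P.Move := inferInstanceAs (Finite Unit)

/-- The game interpreting a formula. -/
def QFormula.interp : QFormula L → Game.{0}
  | .atom _ => Game.empty
  | .all A => Game.before Game.O A.interp
  | .ex A => Game.before Game.P A.interp

/-- The number of quantifiers in front of the quantifier that a move interprets. -/
def QFormula.depth : (A : QFormula L) → A.interp.Move → ℕ
  | .atom _ => Empty.elim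
  | .all A => Sum.elim (fun _ => 0) fun m => A.depth m + 1
  | .ex A => Sum.elim (fun _ => 0) fun m => A.depth m + 1

/-- The quantifiers of a sequent `A ⊢ B`: `inl n` is the `n`-th quantifier of `A` (from the outside,
starting with `0`) and `inr n` is the `n`-th quantifier of `B`. -/
abbrev Position : Type := ℕ ⊕ ℕ

/-- The assignment `ρ` of positions to variables, extended by `p` for a new variable `0`. -/
def consPos (p : Position) (ρ : ℕ → Option Position) : ℕ → Option Position
  | 0 => some p
  | n + 1 => ρ n

namespace SeqProof

variable {Ax : Set (Proposition L × Proposition L)}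

/-- Proofs without the cut rule. -/
def CutFree : {A B : QFormula L} → SeqProof Ax A B → Prop
  | _, _, .allL _ π => π.CutFree
  | _, _, .allR π => π.CutFree
  | _, _, .exL π => π.CutFree
  | _, _, .exR _ π => π.CutFree
  | _, _, .ax _ => True
  | _, _, .cut _ _ => False

/-- `π.Justifies h i j ρ p q` says that, in the cut-free proof `π`, the quantifier `q` is introduced
by a rule `∀`-L or `∃`-R with a witness term in which there is a free variable `x` which is the
variable of the quantifier `p`, introduced by a rule `∀`-R or `∃`-L. The proof `π` is the part of a
larger proof that remains once the first `i` quantifiers on the left and the first `j` on the right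
of its conclusion have been introduced, and `ρ` records which of the variables were introduced by
which of these quantifiers. -/
def Justifies : {A B : QFormula L} → (π : SeqProof Ax A B) → π.CutFree →
    ℕ → ℕ → (ℕ → Option Position) → Position → Position → Prop
  | _, _, .allL t π, h, i, j, ρ, p, q =>
      (q = Sum.inl i ∧ ∃ x ∈ t.varFinset, ρ x = some p) ∨ π.Justifies h (i + 1) j ρ p q
  | _, _, .allR π, h, i, j, ρ, p, q => π.Justifies h i (j + 1) (consPos (Sum.inr j) ρ) p q
  | _, _, .exL π, h, i, j, ρ, p, q => π.Justifies h (i + 1) j (consPos (Sum.inl i) ρ) p q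
  | _, _, .exR t π, h, i, j, ρ, p, q =>
      (q = Sum.inr j ∧ ∃ x ∈ t.varFinset, ρ x = some p) ∨ π.Justifies h i (j + 1) ρ p q
  | _, _, .ax _, _, _, _, _, _, _ => False
  | _, _, .cut _ _, h, _, _, _, _, _ => False.elim h


/-- The number of quantifiers introduced below the rule introducing a given quantifier. -/
def rank : {A B : QFormula L} → SeqProof Ax A B → ℕ → ℕ → Position → ℕ
  | _, _, .allL _ π, i, j, p => if p = Sum.inl i then i + j else π.rank (i + 1) j p
  | _, _, .allR π, i, j, p => if p = Sum.inr j then i + j else π.rank i (j + 1) p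
  | _, _, .exL π, i, j, p => if p = Sum.inl i then i + j else π.rank (i + 1) j p
  | _, _, .exR _ π, i, j, p => if p = Sum.inr j then i + j else π.rank i (j + 1) p
  | _, _, .ax _, i, j, _ => i + j
  | _, _, .cut _ _, i, j, _ => i + j

end SeqProof

/-- The polarity of the `n`-th quantifier of a formula. -/
def QFormula.polAt : QFormula L → ℕ → Option ℤˣ
  | .atom _, _ => none
  | .all _, 0 => some (-1)
  | .ex _, 0 => some 1
  | .all A, n + 1 => A.polAt n
  | .ex A, n + 1 => A.polAt n

theorem QFormula.polAt_subst (A : QFormula L) : ∀ (s : ℕ → L.Term ℕ) (n : ℕ),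
    (A.subst s).polAt n = A.polAt n := by
  induction A with
  | atom P => intro s n; rfl
  | all A ih => intro s n; cases n with
    | zero => rfl
    | succ n => exact ih _ _
  | ex A ih => intro s n; cases n with
    | zero => rfl
    | succ n => exact ih _ _

theorem QFormula.polAt_depth : ∀ (A : QFormula L) (m : A.interp.Move),
    A.polAt (A.depth m) = some (A.interp.pol m)
  | .atom _, m => Empty.elim m
  | .all _, .inl _ => rfl
  | .all A, .inr m => A.polAt_depth m
  | .ex _, .inl _ => rfl
  | .ex A, .inr m => A.polAt_depth m

theorem QFormula.depth_mono : ∀ (A : QFormula L) (m n : A.interp.Move), m ≤ n →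
    m = n ∨ A.depth m < A.depth n
  | .atom _, m, _, _ => Empty.elim m
  | .all _, .inl _, .inl _, _ => Or.inl rfl
  | .all _, .inl _, .inr _, _ => Or.inr (Nat.succ_pos _)
  | .all A, .inr m, .inr n, h =>
      (A.depth_mono m n (by cases h; assumption)).imp (congrArg _) Nat.succ_lt_succ
  | .all _, .inr _, .inl _, h => by cases h
  | .ex _, .inl _, .inl _, _ => Or.inl rfl
  | .ex _, .inl _, .inr _, _ => Or.inr (Nat.succ_pos _)
  | .ex A, .inr m, .inr n, h =>
      (A.depth_mono m n (by cases h; assumption)).imp (congrArg _) Nat.succ_lt_succ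
  | .ex _, .inr _, .inl _, h => by cases h

/-- The polarity of a quantifier of a sequent, of which the first `i` and `j` quantifiers on the two
sides have been removed. -/
def seqPol (A B : QFormula L) (i j : ℕ) : Position → Option ℤˣ
  | .inl n => if i ≤ n then (A.polAt (n - i)).map Neg.neg else none
  | .inr n => if j ≤ n then B.polAt (n - j) else none

theorem seqPol_allL (A B : QFormula L) (s : ℕ → L.Term ℕ) (i j : ℕ) (q : Position) :
    seqPol (.all A) B i j q = if q = Sum.inl i then some 1 else seqPol (A.subst s) B (i + 1) j q := by
  rcases q with n | n
  · rcases lt_trichotomy n i with h | rfl | h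
    · simp [seqPol, h.ne, not_le.2 h, not_le.2 (Nat.lt_succ_of_lt h)]
    · simp [seqPol, QFormula.polAt]
    · obtain ⟨k, rfl⟩ := Nat.exists_eq_add_of_lt h
      have e : i + k + 1 - i = k + 1 := by omega
      have e' : i + k + 1 - (i + 1) = k := by omega
      have e'' : i ≤ i + k + 1 := by omega
      have e3 : i + k + 1 ≠ i := by omega
      simp [seqPol, QFormula.polAt, QFormula.polAt_subst, e, e', e'', e3]
  · simp [seqPol]

theorem seqPol_exL (A B : QFormula L) (s : ℕ → L.Term ℕ) (i j : ℕ) (q : Position) :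
    seqPol (.ex A) B i j q =
      if q = Sum.inl i then some (-1) else seqPol A (B.subst s) (i + 1) j q := by
  rcases q with n | n
  · rcases lt_trichotomy n i with h | rfl | h
    · simp [seqPol, h.ne, not_le.2 h, not_le.2 (Nat.lt_succ_of_lt h)]
    · simp [seqPol, QFormula.polAt]
    · obtain ⟨k, rfl⟩ := Nat.exists_eq_add_of_lt h
      have e : i + k + 1 - i = k + 1 := by omega
      have e' : i + k + 1 - (i + 1) = k := by omega
      have e'' : i ≤ i + k + 1 := by omega
      have e3 : i + k + 1 ≠ i := by omega
      simp [seqPol, QFormula.polAt, e, e', e'', e3]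
  · simp [seqPol, QFormula.polAt_subst]

theorem seqPol_allR (A B : QFormula L) (s : ℕ → L.Term ℕ) (i j : ℕ) (q : Position) :
    seqPol A (.all B) i j q =
      if q = Sum.inr j then some (-1) else seqPol (A.subst s) B i (j + 1) q := by
  rcases q with n | n
  · simp [seqPol, QFormula.polAt_subst]
  · rcases lt_trichotomy n j with h | rfl | h
    · simp [seqPol, h.ne, not_le.2 h, not_le.2 (Nat.lt_succ_of_lt h)]
    · simp [seqPol, QFormula.polAt]
    · obtain ⟨k, rfl⟩ := Nat.exists_eq_add_of_lt h
      have e : j + k + 1 - j = k + 1 := by omega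
      have e' : j + k + 1 - (j + 1) = k := by omega
      have e'' : j ≤ j + k + 1 := by omega
      have e3 : j + k + 1 ≠ j := by omega
      simp [seqPol, QFormula.polAt, e, e', e'', e3]

theorem seqPol_exR (A B : QFormula L) (s : ℕ → L.Term ℕ) (i j : ℕ) (q : Position) :
    seqPol A (.ex B) i j q = if q = Sum.inr j then some 1 else seqPol A (B.subst s) i (j + 1) q := by
  rcases q with n | n
  · simp [seqPol]
  · rcases lt_trichotomy n j with h | rfl | h
    · simp [seqPol, h.ne, not_le.2 h, not_le.2 (Nat.lt_succ_of_lt h)]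
    · simp [seqPol, QFormula.polAt]
    · obtain ⟨k, rfl⟩ := Nat.exists_eq_add_of_lt h
      have e : j + k + 1 - j = k + 1 := by omega
      have e' : j + k + 1 - (j + 1) = k := by omega
      have e'' : j ≤ j + k + 1 := by omega
      have e3 : j + k + 1 ≠ j := by omega
      simp [seqPol, QFormula.polAt, QFormula.polAt_subst, e, e', e'', e3]

theorem seqPol_inl_succ (A B : QFormula L) (i j : ℕ) : seqPol A B (i + 1) j (Sum.inl i) = none := by
  simp [seqPol]

theorem seqPol_inr_succ (A B : QFormula L) (i j : ℕ) : seqPol A B i (j + 1) (Sum.inr j) = none := by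
  simp [seqPol]

theorem consPos_eq {p p' : Position} {ρ : ℕ → Option Position} :
    (∃ x, consPos p ρ x = some p') ↔ p = p' ∨ ∃ x, ρ x = some p' := by
  constructor
  · rintro ⟨_ | x, h⟩
    · exact Or.inl (Option.some.inj h)
    · exact Or.inr ⟨x, h⟩
  · rintro (rfl | ⟨x, h⟩)
    · exact ⟨0, rfl⟩
    · exact ⟨x + 1, h⟩

namespace SeqProof

variable {Ax : Set (Proposition L × Proposition L)}

theorem Justifies.pol_right {A B : QFormula L} (π : SeqProof Ax A B) : ∀ (h : π.CutFree) (i j : ℕ)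
    (ρ : ℕ → Option Position) (p q : Position), π.Justifies h i j ρ p q →
    seqPol A B i j q = some 1 := by
  induction π with
  | allL t π ih =>
    rintro h i j ρ p q (⟨rfl, -⟩ | H)
    · rw [seqPol_allL _ _ FirstOrder.Language.Term.var, if_pos rfl]
    · have H' := ih h _ _ _ _ _ H
      rw [seqPol_allL, if_neg]
      · exact H'
      rintro rfl
      rw [seqPol_inl_succ] at H'; cases H'
  | exR t π ih =>
    rintro h i j ρ p q (⟨rfl, -⟩ | H)
    · rw [seqPol_exR _ _ FirstOrder.Language.Term.var, if_pos rfl]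
    · have H' := ih h _ _ _ _ _ H
      rw [seqPol_exR, if_neg]
      · exact H'
      rintro rfl
      rw [seqPol_inr_succ] at H'; cases H'
  | allR π ih =>
    intro h i j ρ p q H
    have H' := ih h _ _ _ _ _ H
    rw [seqPol_allR, if_neg]
    · exact H'
    rintro rfl
    rw [seqPol_inr_succ] at H'; cases H'
  | exL π ih =>
    intro h i j ρ p q H
    have H' := ih h _ _ _ _ _ H
    rw [seqPol_exL, if_neg]
    · exact H'
    rintro rfl
    rw [seqPol_inl_succ] at H'; cases H'
  | ax h => intro _ _ _ _ _ _ H; exact H.elim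
  | cut π π' => intro h; exact False.elim h

theorem Justifies.pol_left {A B : QFormula L} (π : SeqProof Ax A B) : ∀ (h : π.CutFree) (i j : ℕ)
    (ρ : ℕ → Option Position) (p q : Position), π.Justifies h i j ρ p q →
    (∃ x, ρ x = some p) ∨ seqPol A B i j p = some (-1) := by
  induction π with
  | allL t π ih =>
    rintro h i j ρ p q (⟨-, x, -, hx⟩ | H)
    · exact Or.inl ⟨x, hx⟩
    · refine (ih h _ _ _ _ _ H).imp_right fun H' => ?_
      rw [seqPol_allL, if_neg]
      · exact H'
      rintro rfl
      rw [seqPol_inl_succ] at H'; cases H'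
  | exR t π ih =>
    rintro h i j ρ p q (⟨-, x, -, hx⟩ | H)
    · exact Or.inl ⟨x, hx⟩
    · refine (ih h _ _ _ _ _ H).imp_right fun H' => ?_
      rw [seqPol_exR, if_neg]
      · exact H'
      rintro rfl
      rw [seqPol_inr_succ] at H'; cases H'
  | allR π ih =>
    intro h i j ρ p q H
    rcases ih h _ _ _ _ _ H with H' | H'
    · rcases consPos_eq.1 H' with rfl | H'
      · exact Or.inr (by rw [seqPol_allR _ _ FirstOrder.Language.Term.var, if_pos rfl])
      · exact Or.inl H'
    · right
      rw [seqPol_allR, if_neg]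
      · exact H'
      rintro rfl
      rw [seqPol_inr_succ] at H'; cases H'
  | exL π ih =>
    intro h i j ρ p q H
    rcases ih h _ _ _ _ _ H with H' | H'
    · rcases consPos_eq.1 H' with rfl | H'
      · exact Or.inr (by rw [seqPol_exL _ _ FirstOrder.Language.Term.var, if_pos rfl])
      · exact Or.inl H'
    · right
      rw [seqPol_exL, if_neg]
      · exact H'
      rintro rfl
      rw [seqPol_inl_succ] at H'; cases H'
  | ax h => intro _ _ _ _ _ _ H; exact H.elim
  | cut π π' => intro h; exact False.elim h

theorem le_rank {A B : QFormula L} (π : SeqProof Ax A B) : ∀ (i j : ℕ) (p : Position),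
    i + j ≤ π.rank i j p := by
  induction π with
  | allL t π ih =>
    intro i j p; have := ih (i + 1) j p; simp only [rank]; split <;> omega
  | exR t π ih =>
    intro i j p; have := ih i (j + 1) p; simp only [rank]; split <;> omega
  | allR π ih =>
    intro i j p; have := ih i (j + 1) p; simp only [rank]; split <;> omega
  | exL π ih =>
    intro i j p; have := ih (i + 1) j p; simp only [rank]; split <;> omega
  | ax h => intro i j p; exact le_rfl
  | cut π π' => intro i j p; exact le_rfl

theorem Justifies.rank_lt {A B : QFormula L} (π : SeqProof Ax A B) : ∀ (h : π.CutFree) (i j : ℕ)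
    (ρ : ℕ → Option Position) (p q : Position), π.Justifies h i j ρ p q →
    (∃ x, ρ x = some p) ∨ π.rank i j p < π.rank i j q := by
  induction π with
  | allL t π ih =>
    rintro h i j ρ p q (⟨-, x, -, hx⟩ | H)
    · exact Or.inl ⟨x, hx⟩
    · refine (ih h _ _ _ _ _ H).imp_right fun H' => ?_
      have hq : q ≠ Sum.inl i := by
        rintro rfl
        have := Justifies.pol_right π h _ _ _ _ _ H
        rw [seqPol_inl_succ] at this; cases this
      have := π.le_rank (i + 1) j q
      simp only [rank, if_neg hq]
      split <;> omega
  | exR t π ih =>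
    rintro h i j ρ p q (⟨-, x, -, hx⟩ | H)
    · exact Or.inl ⟨x, hx⟩
    · refine (ih h _ _ _ _ _ H).imp_right fun H' => ?_
      have hq : q ≠ Sum.inr j := by
        rintro rfl
        have := Justifies.pol_right π h _ _ _ _ _ H
        rw [seqPol_inr_succ] at this; cases this
      have := π.le_rank i (j + 1) q
      simp only [rank, if_neg hq]
      split <;> omega
  | allR π ih =>
    intro h i j ρ p q H
    have hq : q ≠ Sum.inr j := by
      rintro rfl
      have := Justifies.pol_right π h _ _ _ _ _ H
      rw [seqPol_inr_succ] at this; cases this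
    have := π.le_rank i (j + 1) q
    simp only [rank, if_neg hq]
    rcases ih h _ _ _ _ _ H with H' | H'
    · rcases consPos_eq.1 H' with rfl | H'
      · right; rw [if_pos rfl]; omega
      · exact Or.inl H'
    · right; split <;> omega
  | exL π ih =>
    intro h i j ρ p q H
    have hq : q ≠ Sum.inl i := by
      rintro rfl
      have := Justifies.pol_right π h _ _ _ _ _ H
      rw [seqPol_inl_succ] at this; cases this
    have := π.le_rank (i + 1) j q
    simp only [rank, if_neg hq]
    rcases ih h _ _ _ _ _ H with H' | H'
    · rcases consPos_eq.1 H' with rfl | H'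
      · right; rw [if_pos rfl]; omega
      · exact Or.inl H'
    · right; split <;> omega
  | ax h => intro _ _ _ _ _ _ H; exact H.elim
  | cut π π' => intro h; exact False.elim h

theorem rank_lt_left {A B : QFormula L} (π : SeqProof Ax A B) : ∀ (_ : π.CutFree) (i j a b : ℕ),
    i ≤ a → a < b → seqPol A B i j (Sum.inl b) ≠ none →
    π.rank i j (Sum.inl a) < π.rank i j (Sum.inl b) := by
  induction π with
  | allL t π ih =>
    intro h i j a b ha hab hb
    have hb' : (Sum.inl b : Position) ≠ Sum.inl i := by simp; omega
    rw [seqPol_allL, if_neg hb'] at hb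
    have := π.le_rank (i + 1) j (Sum.inl b)
    simp only [rank, if_neg hb']
    split
    · omega
    · rename_i h'
      exact ih h _ _ _ _ (Nat.succ_le_of_lt (lt_of_le_of_ne ha fun e => h' (by rw [e]))) hab hb
  | exR t π ih =>
    intro h i j a b ha hab hb
    rw [seqPol_exR, if_neg Sum.inl_ne_inr] at hb
    simp only [rank, if_neg Sum.inl_ne_inr]
    exact ih h _ _ _ _ ha hab hb
  | allR π ih =>
    intro h i j a b ha hab hb
    rw [seqPol_allR, if_neg Sum.inl_ne_inr] at hb
    simp only [rank, if_neg Sum.inl_ne_inr]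
    exact ih h _ _ _ _ ha hab hb
  | exL π ih =>
    intro h i j a b ha hab hb
    have hb' : (Sum.inl b : Position) ≠ Sum.inl i := by simp; omega
    rw [seqPol_exL, if_neg hb'] at hb
    have := π.le_rank (i + 1) j (Sum.inl b)
    simp only [rank, if_neg hb']
    split
    · omega
    · rename_i h'
      exact ih h _ _ _ _ (Nat.succ_le_of_lt (lt_of_le_of_ne ha fun e => h' (by rw [e]))) hab hb
  | ax h => intro _ i j a b ha hab hb; exact absurd (by simp [seqPol, QFormula.polAt]) hb
  | cut π π' => intro h; exact False.elim h

theorem rank_lt_right {A B : QFormula L} (π : SeqProof Ax A B) : ∀ (_ : π.CutFree) (i j a b : ℕ),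
    j ≤ a → a < b → seqPol A B i j (Sum.inr b) ≠ none →
    π.rank i j (Sum.inr a) < π.rank i j (Sum.inr b) := by
  induction π with
  | allR π ih =>
    intro h i j a b ha hab hb
    have hb' : (Sum.inr b : Position) ≠ Sum.inr j := by simp; omega
    rw [seqPol_allR, if_neg hb'] at hb
    have := π.le_rank i (j + 1) (Sum.inr b)
    simp only [rank, if_neg hb']
    split
    · omega
    · rename_i h'
      exact ih h _ _ _ _ (Nat.succ_le_of_lt (lt_of_le_of_ne ha fun e => h' (by rw [e]))) hab hb
  | exL π ih =>
    intro h i j a b ha hab hb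
    rw [seqPol_exL, if_neg Sum.inr_ne_inl] at hb
    simp only [rank, if_neg Sum.inr_ne_inl]
    exact ih h _ _ _ _ ha hab hb
  | allL t π ih =>
    intro h i j a b ha hab hb
    rw [seqPol_allL, if_neg Sum.inr_ne_inl] at hb
    simp only [rank, if_neg Sum.inr_ne_inl]
    exact ih h _ _ _ _ ha hab hb
  | exR t π ih =>
    intro h i j a b ha hab hb
    have hb' : (Sum.inr b : Position) ≠ Sum.inr j := by simp; omega
    rw [seqPol_exR, if_neg hb'] at hb
    have := π.le_rank i (j + 1) (Sum.inr b)
    simp only [rank, if_neg hb']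
    split
    · omega
    · rename_i h'
      exact ih h _ _ _ _ (Nat.succ_le_of_lt (lt_of_le_of_ne ha fun e => h' (by rw [e]))) hab hb
  | ax h => intro _ i j a b ha hab hb; exact absurd (by simp [seqPol, QFormula.polAt]) hb
  | cut π π' => intro h; exact False.elim h

/-- The position of a move of the game interpreting a sequent. -/
def movePos (A B : QFormula L) : (A.interp.arrow B.interp).Move → Position :=
  Sum.map A.depth B.depth

theorem seqPol_movePos (A B : QFormula L) (m : (A.interp.arrow B.interp).Move) :
    seqPol A B 0 0 (movePos A B m) = some ((A.interp.arrow B.interp).pol m) := by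
  rcases m with m | m
  · exact congrArg (Option.map Neg.neg) (A.polAt_depth m)
  · exact B.polAt_depth m

/-- The strategy on `⟦A⟧ ⊸ ⟦B⟧` interpreting a cut-free proof of `A ⊢ B`. -/
def interp {A B : QFormula L} (π : SeqProof Ax A B) (h : π.CutFree) :
    Strategy (A.interp.arrow B.interp) :=
  have hpol : ∀ m n, π.Justifies h 0 0 (fun _ => none) (movePos A B m) (movePos A B n) →
      (A.interp.arrow B.interp).pol m = -1 ∧ (A.interp.arrow B.interp).pol n = 1 := by
    intro m n H
    have h1 := Justifies.pol_left π h _ _ _ _ _ H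
    have h2 := Justifies.pol_right π h _ _ _ _ _ H
    rw [seqPol_movePos] at h1 h2
    rcases h1 with ⟨_, h1⟩ | h1
    · cases h1
    · exact ⟨Option.some.inj h1, Option.some.inj h2⟩
  have hrank : ∀ m n, Relation.TransGen (fun a b => a ≤ b ∨
      (a = b ∨ π.Justifies h 0 0 (fun _ => none) (movePos A B a) (movePos A B b))) m n →
      m = n ∨ π.rank 0 0 (movePos A B m) < π.rank 0 0 (movePos A B n) := by
    have step : ∀ m n : (A.interp.arrow B.interp).Move, (m ≤ n ∨
        (m = n ∨ π.Justifies h 0 0 (fun _ => none) (movePos A B m) (movePos A B n))) →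
        m = n ∨ π.rank 0 0 (movePos A B m) < π.rank 0 0 (movePos A B n) := by
      rintro m n (H | H | H)
      · have hn := seqPol_movePos A B n
        rcases m with m | m <;> rcases n with n | n
        · rcases A.depth_mono m n (Sum.inl_le_inl_iff.1 H) with rfl | H'
          · exact Or.inl rfl
          · exact Or.inr (rank_lt_left π h 0 0 _ _ (Nat.zero_le _) H' (by
              intro e; rw [show movePos A B (Sum.inl n) = Sum.inl (A.depth n) from rfl, e] at hn
              cases hn))
        · exact absurd H Sum.not_inl_le_inr
        · exact absurd H Sum.not_inr_le_inl
        · rcases B.depth_mono m n (Sum.inr_le_inr_iff.1 H) with rfl | H'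
          · exact Or.inl rfl
          · exact Or.inr (rank_lt_right π h 0 0 _ _ (Nat.zero_le _) H' (by
              intro e; rw [show movePos A B (Sum.inr n) = Sum.inr (B.depth n) from rfl, e] at hn
              cases hn))
      · exact Or.inl H
      · rcases Justifies.rank_lt π h _ _ _ _ _ H with ⟨_, e⟩ | H'
        · cases e
        · exact Or.inr H'
    intro m n H
    induction H with
    | single H => exact step _ _ H
    | tail _ H ih =>
      rcases step _ _ H with rfl | H'
      · exact ih
      · rcases ih with rfl | ih
        · exact Or.inr H'
        · exact Or.inr (ih.trans H')
  { rel := fun m n => m = n ∨ π.Justifies h 0 0 (fun _ => none) (movePos A B m) (movePos A B n)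
    refl := fun _ => Or.inl rfl
    trans := by
      rintro l m n (rfl | H) H'
      · exact H'
      · rcases H' with rfl | H'
        · exact Or.inr H
        · exact absurd ((hpol _ _ H).2.symm.trans (hpol _ _ H').1) (by decide)
    polarity := fun m n H hne => hpol m n (H.resolve_left hne)
    antisymm := by
      rintro m n (rfl | H) H'
      · rfl
      · rcases H' with rfl | H'
        · rfl
        · exact absurd ((hpol _ _ H).2.symm.trans (hpol _ _ H').1) (by decide)
    acyclic := by
      intro m n H H'
      rcases hrank _ _ H with e | h1
      · exact e
      · rcases hrank _ _ H' with e | h2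
        · exact e.symm
        · exact absurd h1 h2.asymm }

end SeqProof

/-- A cyclic strategy on `A ⊸ B` is definable, with respect to a set of axioms, when it is, up to
isomorphisms of games `⟦F⟧ ≅ A` and `⟦G⟧ ≅ B`, the interpretation of a cut-free proof of some
sequent `F ⊢ G`. -/
def Definable (Ax : Set (Proposition L × Proposition L)) {A B : Game.{w}}
    (σ : CyclicStrategy (A.arrow B)) : Prop :=
  ∃ (F G : QFormula L) (i : Game.Iso F.interp A) (j : Game.Iso G.interp B)
    (π : SeqProof Ax F G) (h : π.CutFree), ∀ m n : F.interp.Move ⊕ G.interp.Move,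
      (π.interp h).rel m n ↔
        σ.rel (Sum.map i.toEquiv j.toEquiv m) (Sum.map i.toEquiv j.toEquiv n)

end Interpretation

/-! ## The set of axioms -/

section Axioms

/-- The function symbols `⊤`, `⊥`, `∧` and `∨`. -/
inductive LogicFunction : ℕ → Type
  | top : LogicFunction 0
  | bot : LogicFunction 0
  | and : LogicFunction 2
  | or : LogicFunction 2

/-- The closure of a set of proposition symbols under formal conjunctions and disjunctions, with a
unary symbol `I` and nullary symbols `⊤` and `⊥`. -/
inductive PropSymbol (R : ℕ → Type v) : ℕ → Type v
  | base {n : ℕ} (r : R n) : PropSymbol R n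
  | ofTerm : PropSymbol R 1
  | top : PropSymbol R 0
  | bot : PropSymbol R 0
  | and {m n : ℕ} (p : PropSymbol R m) (q : PropSymbol R n) : PropSymbol R (m + n)
  | or {m n : ℕ} (p : PropSymbol R m) (q : PropSymbol R n) : PropSymbol R (m + n)

/-- The first-order language obtained from `L` by adding the unary proposition symbol `I` and by
closing terms and propositions under formal `⊤`, `⊥`, `∧` and `∨`. -/
def FirstOrder.Language.logicClosure (L : FirstOrder.Language.{u, v}) :
    FirstOrder.Language.{u, v} where
  Functions n := L.Functions n ⊕ LogicFunction n
  Relations := PropSymbol L.Relations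

variable {L : FirstOrder.Language.{u, v}}

namespace LogicTerm

/-- The term `⊤`. -/
def top : L.logicClosure.Term ℕ := .func (Sum.inr LogicFunction.top) ![]

/-- The term `⊥`. -/
def bot : L.logicClosure.Term ℕ := .func (Sum.inr LogicFunction.bot) ![]

/-- The term `s ∧ t`. -/
def and (s t : L.logicClosure.Term ℕ) : L.logicClosure.Term ℕ :=
  .func (Sum.inr LogicFunction.and) ![s, t]

/-- The term `s ∨ t`. -/
def or (s t : L.logicClosure.Term ℕ) : L.logicClosure.Term ℕ :=
  .func (Sum.inr LogicFunction.or) ![s, t]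

end LogicTerm

namespace Proposition

/-- The proposition `I(t)`. -/
def ofTerm (t : L.logicClosure.Term ℕ) : Proposition L.logicClosure := ⟨1, .ofTerm, ![t]⟩

/-- The proposition `⊤`. -/
def top : Proposition L.logicClosure := ⟨0, .top, ![]⟩

/-- The proposition `⊥`. -/
def bot : Proposition L.logicClosure := ⟨0, .bot, ![]⟩

/-- The proposition `P ∧ Q`. -/
def and (P Q : Proposition L.logicClosure) : Proposition L.logicClosure :=
  ⟨P.arity + Q.arity, .and P.sym Q.sym, Fin.append P.args Q.args⟩

/-- The proposition `P ∨ Q`. -/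
def or (P Q : Proposition L.logicClosure) : Proposition L.logicClosure :=
  ⟨P.arity + Q.arity, .or P.sym Q.sym, Fin.append P.args Q.args⟩

/-- The smallest reflexive and transitive relation on propositions which treats the formal `⊤`, `⊥`,
`∧` and `∨` as lattice operations, and for which the identification of a term `t` with the
proposition `I(t)` is compatible with them. -/
inductive Entails : Proposition L.logicClosure → Proposition L.logicClosure → Prop
  | refl (P) : Entails P P
  | trans {P Q R} : Entails P Q → Entails Q R → Entails P R
  | le_top (P) : Entails P top
  | bot_le (P) : Entails bot P
  | le_and {P P₁ P₂} : Entails P P₁ → Entails P P₂ → Entails P (and P₁ P₂)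
  | le_or_left {P P₁ P₂} : Entails P P₁ → Entails P (or P₁ P₂)
  | le_or_right {P P₁ P₂} : Entails P P₂ → Entails P (or P₁ P₂)
  | and_le_left {P P₁ P₂} : Entails P₁ P → Entails (and P₁ P₂) P
  | and_le_right {P P₁ P₂} : Entails P₂ P → Entails (and P₁ P₂) P
  | or_le {P P₁ P₂} : Entails P₁ P → Entails P₂ P → Entails (or P₁ P₂) P
  | top_le_ofTerm : Entails top (ofTerm LogicTerm.top)
  | ofTerm_le_bot : Entails (ofTerm LogicTerm.bot) bot
  | ofTerm_and (s t) : Entails (ofTerm (LogicTerm.and s t)) (and (ofTerm s) (ofTerm t))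
  | and_ofTerm (s t) : Entails (and (ofTerm s) (ofTerm t)) (ofTerm (LogicTerm.and s t))
  | ofTerm_or (s t) : Entails (ofTerm (LogicTerm.or s t)) (or (ofTerm s) (ofTerm t))
  | or_ofTerm (s t) : Entails (or (ofTerm s) (ofTerm t)) (ofTerm (LogicTerm.or s t))

end Proposition

/-- The set of axioms `Ax`. -/
def standardAx (L : FirstOrder.Language.{u, v}) :
    Set (Proposition L.logicClosure × Proposition L.logicClosure) :=
  {x | Proposition.Entails x.1 x.2}

end Axioms

/-! ## Acyclicity of composites -/

/-! ### Unions of two acyclic relations -/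

namespace Relation

/-! The theorem is the conjunction of three facts with separate proofs. The first two below give
definability.

Every morphism σ is acyclic: no cycle mixes σ with the causality of the game
(`GamesHom.finiteFiliform_and_acyclic`). Only composition is delicate. A cycle in a composite lifts
to `A ⊎ B ⊎ C`, where each edge belongs to one of two acyclic relations, living on `A ⊎ B` and on `B
⊎ C`. Both contain the causality of `B`, which is total, so acyclicity forces both transitive
closures to restrict to that one order on `B`. A path can therefore be shortened until it passes at
most once from one relation to the other, and the lifted cycle collapses
(`Relation.antisymm_transGen_union`).

Every acyclic σ is a proof (`SeqProof.exists_justifies_iff`, `CyclicStrategy.Acyclic.definable`).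
The games become prenex formulas, and a proof is searched bottom-up. Opponent quantifiers are
introduced as soon as one heads its side. A Proponent quantifier is introduced once all the moves
below it in σ have their variables in scope; its witness is the disjunction of exactly these
variables. The search gets stuck only if the two head quantifiers wait for each other, through
quantifiers further inside the opposite formulas, and this is a cycle of σ with causality. At the
end the matrices are related through ⊤: the right one is a disjunction that contains ⊤, which
survives every substitution.

Coherence is soundness for truth values: the logical symbols have their usual meaning, `I` is the
identity, everything else is false, and quantifiers range over truth values (`SeqProof.holds`). -/

theorem TransGen.exists_of_map {α β : Type*} {r : α → α → Prop} {f : α → β}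
    (hf : f.Injective) {x y : β} (h : TransGen (Relation.Map r f f) x y) :
    ∃ a b, f a = x ∧ f b = y ∧ TransGen r a b := by
  induction h with
  | single h =>
    obtain ⟨a, b, h, rfl, rfl⟩ := h
    exact ⟨a, b, rfl, rfl, .single h⟩
  | tail _ h ih =>
    obtain ⟨a, b, rfl, rfl, h'⟩ := ih
    obtain ⟨b', c, h, e, rfl⟩ := h
    obtain rfl := hf e
    exact ⟨a, c, rfl, rfl, h'.tail h⟩

/-- If two acyclic relations agree and are total on the intersection of their supports, then their
union is acyclic. -/
theorem antisymm_transGen_union {X : Type*} {r s : X → X → Prop} (M N : Set X)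
    (hr : ∀ x y, r x y → x ∈ M ∧ y ∈ M) (hs : ∀ x y, s x y → x ∈ N ∧ y ∈ N)
    (hB : ∀ x ∈ M ∩ N, ∀ y ∈ M ∩ N, (r x y ∧ s x y) ∨ (r y x ∧ s y x))
    (ar : ∀ x y, TransGen r x y → TransGen r y x → x = y)
    (as : ∀ x y, TransGen s x y → TransGen s y x → x = y) {x y : X}
    (hxy : TransGen (fun a b => r a b ∨ s a b) x y)
    (hyx : TransGen (fun a b => r a b ∨ s a b) y x) : x = y := by
  have hR : ∀ x y, TransGen r x y → x ∈ M ∧ y ∈ M := by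
    intro x y h
    induction h with
    | single h => exact hr _ _ h
    | tail _ h ih => exact ⟨ih.1, (hr _ _ h).2⟩
  have hS : ∀ x y, TransGen s x y → x ∈ N ∧ y ∈ N := by
    intro x y h
    induction h with
    | single h => exact hs _ _ h
    | tail _ h ih => exact ⟨ih.1, (hs _ _ h).2⟩
  -- On the intersection both closures are the common total order: a path against a common edge
  -- forces equality by acyclicity, and the totality condition at a single point gives reflexivity.
  have hRS : ∀ x ∈ M ∩ N, ∀ y ∈ M ∩ N, (TransGen r x y ↔ TransGen s x y) := by
    intro x hx y hy
    rcases hB x hx y hy with ⟨h, h'⟩ | ⟨h, h'⟩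
    · exact ⟨fun _ => .single h', fun _ => .single h⟩
    · have hxx : r x x ∧ s x x := or_self_iff.1 (hB x hx x hx)
      constructor
      · intro H
        obtain rfl := ar x y H (.single h)
        exact .single hxx.2
      · intro H
        obtain rfl := as x y H (.single h')
        exact .single hxx.1
  let W : X → X → Prop := fun x y => TransGen r x y ∨ TransGen s x y
  -- When two paths of different kinds meet, the meeting point is in `M ∩ N`. If an endpoint is
  -- there too, the path between these two points can be exchanged for one of the other kind.
  have trans_of_mem : ∀ x y z, W x y → W y z → (x ∈ M ∩ N ∨ z ∈ M ∩ N) → W x z := by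
    rintro x y z (h | h) (h' | h') hm
    · exact Or.inl (h.trans h')
    · have hy : y ∈ M ∩ N := ⟨(hR _ _ h).2, (hS _ _ h').1⟩
      rcases hm with hm | hm
      · exact Or.inr (((hRS _ hm _ hy).1 h).trans h')
      · exact Or.inl (h.trans ((hRS _ hy _ hm).2 h'))
    · have hy : y ∈ M ∩ N := ⟨(hR _ _ h').1, (hS _ _ h).2⟩
      rcases hm with hm | hm
      · exact Or.inl (((hRS _ hm _ hy).2 h).trans h')
      · exact Or.inr (h.trans ((hRS _ hy _ hm).1 h'))
    · exact Or.inr (h.trans h')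
  have antisymm : ∀ x y, W x y → W y x → x = y := by
    rintro x y (h | h) (h' | h')
    · exact ar _ _ h h'
    · exact ar _ _ h ((hRS _ ⟨(hR _ _ h).2, (hS _ _ h').1⟩ _ ⟨(hR _ _ h).1, (hS _ _ h').2⟩).2 h')
    · exact as _ _ h ((hRS _ ⟨(hR _ _ h').1, (hS _ _ h).2⟩ _ ⟨(hR _ _ h').2, (hS _ _ h).1⟩).1 h')
    · exact as _ _ h h'
  -- Normal form of a path: at most one change of relation. Once a point `b` of `M ∩ N` has been
  -- met, all that follows is absorbed into a single `W`-step from `b`.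
  have key : ∀ x y, TransGen (fun a b => r a b ∨ s a b) x y →
      W x y ∨ ∃ b ∈ M ∩ N, W x b ∧ W b y := by
    intro x y h
    induction h with
    | single h => exact Or.inl (h.imp TransGen.single TransGen.single)
    | @tail y z _ h ih =>
      have hyz : W y z := h.imp TransGen.single TransGen.single
      rcases ih with hxy | ⟨b, hb, hxb, hby⟩
      · rcases hxy with hxy | hxy <;> rcases h with h | h
        · exact Or.inl (Or.inl (hxy.tail h))
        · exact Or.inr ⟨y, ⟨(hR _ _ hxy).2, (hs _ _ h).1⟩, Or.inl hxy, hyz⟩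
        · exact Or.inr ⟨y, ⟨(hr _ _ h).1, (hS _ _ hxy).2⟩, Or.inr hxy, hyz⟩
        · exact Or.inl (Or.inr (hxy.tail h))
      · exact Or.inr ⟨b, hb, hxb, trans_of_mem _ _ _ hby hyz (Or.inl hb)⟩
  rcases key _ _ hxy with h | ⟨b, hb, h1, h2⟩ <;> rcases key _ _ hyx with h' | ⟨c, hc, h3, h4⟩
  · exact antisymm _ _ h h'
  · obtain rfl := antisymm _ _ (trans_of_mem _ _ _ h h3 (Or.inr hc)) h4
    exact antisymm _ _ h h3
  · obtain rfl := antisymm _ _ h1 (trans_of_mem _ _ _ h2 h' (Or.inl hb))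
    exact antisymm _ _ h2 h'
  -- The cycle is `x → b → y → c → x`. Contracting at `y` and at `x` gives `b → c → b`, so `b = c`;
  -- then `x` and `y` are each in a two-step cycle with this point.
  · obtain rfl := antisymm _ _ (trans_of_mem _ _ _ h2 h3 (Or.inl hb))
      (trans_of_mem _ _ _ h4 h1 (Or.inl hc))
    rw [antisymm _ _ h1 h4, antisymm _ _ h2 h3]

end Relation

/-! ### Acyclicity of identities and composites -/

namespace CyclicStrategy

/-- A cyclic strategy is acyclic when the transitive closure of its union with the causality of the
game is antisymmetric. -/
def Acyclic {A : Game.{u}} (σ : CyclicStrategy A) : Prop :=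
  ∀ m n, Relation.TransGen (fun a b => a ≤ b ∨ σ.rel a b) m n →
    Relation.TransGen (fun a b => a ≤ b ∨ σ.rel a b) n m → m = n

/-- Fold the two copies of `A` onto one. A nontrivial causality step strictly increases the folded
move; a nontrivial identity step fixes it and goes from Opponent to Proponent, so two of them are
never consecutive. No nontrivial path can then return to its start. -/
theorem Acyclic.id (A : Game.{u}) : (CyclicStrategy.id A).Acyclic := by
  let f : (A.arrow A).Move → A.Move := Sum.elim _root_.id _root_.id
  have step : ∀ m n : (A.arrow A).Move, m ≤ n ∨ (CyclicStrategy.id A).rel m n →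
      m = n ∨ f m < f n ∨ (f m = f n ∧ (A.arrow A).pol m = -1 ∧ (A.arrow A).pol n = 1) := by
    rintro m n (h | h)
    · rcases m with m | m <;> rcases n with n | n
      · rcases (Sum.inl_le_inl_iff.1 h).eq_or_lt with e | e
        · exact Or.inl (congrArg Sum.inl e)
        · exact Or.inr (Or.inl e)
      · exact absurd h Sum.not_inl_le_inr
      · exact absurd h Sum.not_inr_le_inl
      · rcases (Sum.inr_le_inr_iff.1 h).eq_or_lt with e | e
        · exact Or.inl (congrArg Sum.inr e)
        · exact Or.inr (Or.inl e)
    · by_cases hmn : m = n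
      · exact Or.inl hmn
      · refine Or.inr (Or.inr ⟨?_, (CyclicStrategy.id A).polarity m n h hmn⟩)
        rcases h with h | ⟨a, -, rfl, rfl⟩ | ⟨a, -, rfl, rfl⟩
        · exact absurd h hmn
        · rfl
        · rfl
  have key : ∀ m n : (A.arrow A).Move,
      Relation.TransGen (fun a b => a ≤ b ∨ (CyclicStrategy.id A).rel a b) m n →
      m = n ∨ f m < f n ∨ (f m = f n ∧ (A.arrow A).pol m = -1 ∧ (A.arrow A).pol n = 1) := by
    intro m n h
    induction h with
    | single h => exact step _ _ h
    | tail _ h ih =>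
      rcases step _ _ h with rfl | h | ⟨h, h1, h2⟩
      · exact ih
      · rcases ih with rfl | ih | ⟨e, -⟩
        · exact Or.inr (Or.inl h)
        · exact Or.inr (Or.inl (ih.trans h))
        · exact Or.inr (Or.inl (e.trans_lt h))
      · rcases ih with rfl | ih | ⟨-, -, h3⟩
        · exact Or.inr (Or.inr ⟨h, h1, h2⟩)
        · exact Or.inr (Or.inl (ih.trans_eq h))
        · exact absurd (h3.symm.trans h1) (by decide)
  intro m n h h'
  rcases key m n h with e | h | ⟨h, h1, h2⟩
  · exact e
  · rcases key n m h' with e | h' | ⟨h', -⟩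
    · exact e.symm
    · exact absurd h h'.asymm
    · exact absurd h' h.ne'
  · rcases key n m h' with e | h' | ⟨-, h3, -⟩
    · exact e.symm
    · exact absurd h h'.ne'
    · exact absurd (h2.symm.trans h3) (by decide)

/-- The composite of two acyclic cyclic strategies through a totally ordered game is acyclic. -/
theorem Acyclic.comp {A B C : Game.{u}} {σ : CyclicStrategy (A.arrow B)}
    {τ : CyclicStrategy (B.arrow C)} (hB : ∀ m n : B.Move, m ≤ n ∨ n ≤ m) (hσ : σ.Acyclic)
    (hτ : τ.Acyclic) : (σ.comp τ).Acyclic := by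
  let f : (A.arrow B).Move → A.Move ⊕ (B.Move ⊕ C.Move) := Sum.map _root_.id Sum.inl
  let g : (B.arrow C).Move → A.Move ⊕ (B.Move ⊕ C.Move) := Sum.inr
  let k : (A.arrow C).Move → A.Move ⊕ (B.Move ⊕ C.Move) := Sum.map _root_.id Sum.inr
  have hf : f.Injective := Function.Injective.sumMap Function.injective_id Sum.inl_injective
  have hg : g.Injective := Sum.inr_injective
  have hk : k.Injective := Function.Injective.sumMap Function.injective_id Sum.inr_injective
  let r := Relation.Map (fun a b => a ≤ b ∨ σ.rel a b) f f
  let s := Relation.Map (fun a b => a ≤ b ∨ τ.rel a b) g g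
  -- Dualizing `B` changes only polarities, so its causality order occurs in both relations, in the
  -- same direction.
  have hle : ∀ a b : B.Move, a ≤ b →
      r (Sum.inr (Sum.inl a)) (Sum.inr (Sum.inl b)) ∧
        s (Sum.inr (Sum.inl a)) (Sum.inr (Sum.inl b)) := fun a b h =>
    ⟨⟨Sum.inr a, Sum.inr b, Or.inl (Sum.inr_le_inr_iff.2 h), rfl, rfl⟩,
      ⟨Sum.inl a, Sum.inl b, Or.inl (Sum.inl_le_inl_iff.2 h), rfl, rfl⟩⟩
  have hinter : ∀ x ∈ Set.range f ∩ Set.range g, ∃ b : B.Move, Sum.inr (Sum.inl b) = x := by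
    rintro _ ⟨⟨a | b, rfl⟩, ⟨c, h⟩⟩
    · cases h
    · exact ⟨b, rfl⟩
  have hlift : ∀ m n, Relation.TransGen (fun a b => a ≤ b ∨ (σ.comp τ).rel a b) m n →
      Relation.TransGen (fun a b => r a b ∨ s a b) (k m) (k n) := by
    intro m n h
    -- An edge of the composite is itself a path through `B`, so edges are replaced by paths, which
    -- are then concatenated.
    refine Relation.TransGen.trans_induction_on h (fun {m n} h => ?_)
      (fun _ _ h h' => h.trans h')
    rcases h with h | h
    · refine .single ?_
      rcases m with m | m <;> rcases n with n | n
      · exact Or.inl ⟨Sum.inl m, Sum.inl n, Or.inl (Sum.inl_le_inl_iff.2 (Sum.inl_le_inl_iff.1 h)),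
          rfl, rfl⟩
      · exact absurd h Sum.not_inl_le_inr
      · exact absurd h Sum.not_inr_le_inl
      · exact Or.inr ⟨Sum.inr m, Sum.inr n, Or.inl (Sum.inr_le_inr_iff.2 (Sum.inr_le_inr_iff.1 h)),
          rfl, rfl⟩
    · have h : Relation.TransGen (union σ τ) (k m) (k n) := h
      refine Relation.TransGen.mono ?_ _ _ h
      rintro x y (⟨a, b, h, rfl, rfl⟩ | ⟨a, b, h, rfl, rfl⟩)
      · exact Or.inl ⟨a, b, Or.inr h, rfl, rfl⟩
      · exact Or.inr ⟨a, b, Or.inr h, rfl, rfl⟩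
  intro m n h h'
  refine hk (Relation.antisymm_transGen_union (r := r) (s := s) (Set.range f) (Set.range g)
    ?_ ?_ ?_ ?_ ?_ (hlift _ _ h) (hlift _ _ h'))
  · rintro _ _ ⟨a, b, -, rfl, rfl⟩
    exact ⟨⟨a, rfl⟩, ⟨b, rfl⟩⟩
  · rintro _ _ ⟨a, b, -, rfl, rfl⟩
    exact ⟨⟨a, rfl⟩, ⟨b, rfl⟩⟩
  · intro x hx y hy
    obtain ⟨b, rfl⟩ := hinter x hx
    obtain ⟨c, rfl⟩ := hinter y hy
    exact (hB b c).imp (hle b c) (hle c b)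
  · intro x y h h'
    obtain ⟨a, b, rfl, rfl, hab⟩ := Relation.TransGen.exists_of_map hf h
    obtain ⟨b', a', e, e', hba⟩ := Relation.TransGen.exists_of_map hf h'
    rw [hf e, hf e'] at hba
    rw [hσ a b hab hba]
  · intro x y h h'
    obtain ⟨a, b, rfl, rfl, hab⟩ := Relation.TransGen.exists_of_map hg h
    obtain ⟨b', a', e, e', hba⟩ := Relation.TransGen.exists_of_map hg h'
    rw [hg e, hg e'] at hba
    rw [hτ a b hab hba]

end CyclicStrategy

/-- The morphisms of the category of games are strategies between finite filiform games. -/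
theorem GamesHom.finiteFiliform_and_acyclic {A B : Game.{u}} {σ : CyclicStrategy (A.arrow B)}
    (h : GamesHom σ) : A.FiniteFiliform ∧ B.FiniteFiliform ∧ σ.Acyclic := by
  induction h with
  | ofStrategy hA hB σ => exact ⟨hA, hB, σ.acyclic⟩
  | id hA => exact ⟨hA, hA, .id _⟩
  | comp _ _ ihσ ihτ => exact ⟨ihσ.1, ihτ.2.1, .comp ihσ.2.1.total ihσ.2.2 ihτ.2.2⟩

/-! ## The set of axioms -/

section

variable {L : FirstOrder.Language.{u, v}}

/-! ### Substitution in the formal connectives -/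

namespace Proposition

theorem subst_top (s : ℕ → L.logicClosure.Term ℕ) :
    (top : Proposition L.logicClosure).subst s = top :=
  congrArg (Proposition.mk 0 _) (Subsingleton.elim _ _)

theorem subst_bot (s : ℕ → L.logicClosure.Term ℕ) :
    (bot : Proposition L.logicClosure).subst s = bot :=
  congrArg (Proposition.mk 0 _) (Subsingleton.elim _ _)

theorem subst_ofTerm (t : L.logicClosure.Term ℕ) (s : ℕ → L.logicClosure.Term ℕ) :
    (ofTerm t).subst s = ofTerm (t.subst s) :=
  congrArg (Proposition.mk 1 _) (funext fun i => by fin_cases i; rfl)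

theorem subst_append {P Q : Proposition L.logicClosure} (s : ℕ → L.logicClosure.Term ℕ) :
    (fun i => (Fin.append P.args Q.args i).subst s) =
      Fin.append (P.subst s).args (Q.subst s).args := by
  funext i
  refine Fin.addCases (fun i => ?_) (fun i => ?_) i
  · rw [Fin.append_left]; exact (Fin.append_left (P.subst s).args (Q.subst s).args i).symm
  · rw [Fin.append_right]; exact (Fin.append_right (P.subst s).args (Q.subst s).args i).symm

theorem subst_and (P Q : Proposition L.logicClosure) (s : ℕ → L.logicClosure.Term ℕ) :
    (and P Q).subst s = and (P.subst s) (Q.subst s) :=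
  congrArg (Proposition.mk (P.arity + Q.arity) _) (subst_append s)

theorem subst_or (P Q : Proposition L.logicClosure) (s : ℕ → L.logicClosure.Term ℕ) :
    (or P Q).subst s = or (P.subst s) (Q.subst s) :=
  congrArg (Proposition.mk (P.arity + Q.arity) _) (subst_append s)

end Proposition

namespace LogicTerm

theorem subst_top (s : ℕ → L.logicClosure.Term ℕ) : (top (L := L)).subst s = top :=
  congrArg (FirstOrder.Language.Term.func _) (Subsingleton.elim _ _)

theorem subst_bot (s : ℕ → L.logicClosure.Term ℕ) : (bot (L := L)).subst s = bot :=
  congrArg (FirstOrder.Language.Term.func _) (Subsingleton.elim _ _)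

theorem subst_and (t t' : L.logicClosure.Term ℕ) (s : ℕ → L.logicClosure.Term ℕ) :
    (and t t').subst s = and (t.subst s) (t'.subst s) :=
  congrArg (FirstOrder.Language.Term.func _) (funext fun i => by fin_cases i <;> rfl)

theorem subst_or (t t' : L.logicClosure.Term ℕ) (s : ℕ → L.logicClosure.Term ℕ) :
    (or t t').subst s = or (t.subst s) (t'.subst s) :=
  congrArg (FirstOrder.Language.Term.func _) (funext fun i => by fin_cases i <;> rfl)

/-- The disjunction of a list of variables. -/
def joinVars (l : List ℕ) : L.logicClosure.Term ℕ :=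
  l.foldr (fun x t => or (.var x) t) top

/-- Justification sees only the free variables of a witness, so terms with an arbitrary prescribed
finite set of variables, possibly empty, are all that definability requires of the function symbols.
-/
theorem varFinset_joinVars (l : List ℕ) : (joinVars (L := L) l).varFinset = l.toFinset := by
  induction l with
  | nil => rfl
  | cons x l ih =>
    have h : (joinVars (L := L) (x :: l)).varFinset = {x} ∪ (joinVars (L := L) l).varFinset := by
      ext y
      simp [joinVars, or, FirstOrder.Language.Term.varFinset, Fin.exists_fin_two]
    rw [h, ih, List.toFinset_cons]
    rfl

end LogicTerm

namespace Proposition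

/-- The disjunction ends with ⊤, and `I` commutes with disjunctions, so it holds whatever the
variables stand for. -/
theorem Entails.top_le_ofTerm_joinVars (l : List ℕ) :
    Entails top (ofTerm (LogicTerm.joinVars (L := L) l)) := by
  induction l with
  | nil => exact .top_le_ofTerm
  | cons x l ih => exact .trans (.le_or_right ih) (.or_ofTerm _ _)

theorem Entails.subst {P Q : Proposition L.logicClosure} (s : ℕ → L.logicClosure.Term ℕ)
    (h : Entails P Q) : Entails (P.subst s) (Q.subst s) := by
  induction h with
  | refl P => exact .refl _
  | trans _ _ ih ih' => exact .trans ih ih'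
  | le_top P => rw [subst_top]; exact .le_top _
  | bot_le P => rw [subst_bot]; exact .bot_le _
  | le_and _ _ ih ih' => rw [subst_and]; exact .le_and ih ih'
  | le_or_left _ ih => rw [subst_or]; exact .le_or_left ih
  | le_or_right _ ih => rw [subst_or]; exact .le_or_right ih
  | and_le_left _ ih => rw [subst_and]; exact .and_le_left ih
  | and_le_right _ ih => rw [subst_and]; exact .and_le_right ih
  | or_le _ _ ih ih' => rw [subst_or]; exact .or_le ih ih'
  | top_le_ofTerm => rw [subst_top, subst_ofTerm, LogicTerm.subst_top]; exact .top_le_ofTerm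
  | ofTerm_le_bot => rw [subst_bot, subst_ofTerm, LogicTerm.subst_bot]; exact .ofTerm_le_bot
  | ofTerm_and t t' =>
    simp only [subst_and, subst_ofTerm, LogicTerm.subst_and]; exact .ofTerm_and _ _
  | and_ofTerm t t' =>
    simp only [subst_and, subst_ofTerm, LogicTerm.subst_and]; exact .and_ofTerm _ _
  | ofTerm_or t t' =>
    simp only [subst_or, subst_ofTerm, LogicTerm.subst_or]; exact .ofTerm_or _ _
  | or_ofTerm t t' =>
    simp only [subst_or, subst_ofTerm, LogicTerm.subst_or]; exact .or_ofTerm _ _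

end Proposition

theorem isAxiomSet_standardAx : IsAxiomSet (standardAx L) where
  refl := .refl
  trans _ _ _ := .trans
  subst _ _ s := .subst s

/-! ## Coherence -/

/-- The interpretation of the function symbols on truth values: the logical symbols have their
usual meaning, the others are constantly false. -/
def LogicFunction.eval : ∀ {n : ℕ}, LogicFunction n → (Fin n → Prop) → Prop
  | _, .top, _ => True
  | _, .bot, _ => False
  | _, .and, x => x 0 ∧ x 1
  | _, .or, x => x 0 ∨ x 1

/-- The interpretation of the proposition symbols on truth values. -/
def PropSymbol.eval {R : ℕ → Type v} : ∀ {n : ℕ}, PropSymbol R n → (Fin n → Prop) → Prop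
  | _, .base _, _ => False
  | _, .ofTerm, x => x 0
  | _, .top, _ => True
  | _, .bot, _ => False
  | _, .and p q, x => p.eval (fun i => x (Fin.castAdd _ i)) ∧ q.eval (fun i => x (Fin.natAdd _ i))
  | _, .or p q, x => p.eval (fun i => x (Fin.castAdd _ i)) ∨ q.eval (fun i => x (Fin.natAdd _ i))

/-- Truth values as a model. -/
instance truthStructure : L.logicClosure.Structure Prop where
  funMap {_} f x := Sum.elim (fun _ => False) (fun g => g.eval x) f
  RelMap p x := PropSymbol.eval p x

/-- The truth value of a proposition under a valuation of the variables. -/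
def Proposition.Holds (P : Proposition L.logicClosure) (e : ℕ → Prop) : Prop :=
  PropSymbol.eval P.sym fun i => (P.args i).realize e

/-- A valuation of the variables, extended by `x` for a new variable `0`. -/
def consVal (x : Prop) (e : ℕ → Prop) : ℕ → Prop
  | 0 => x
  | n + 1 => e n

/-- The truth value of a formula under a valuation of the variables. -/
def QFormula.Holds : QFormula L.logicClosure → (ℕ → Prop) → Prop
  | .atom P, e => P.Holds e
  | .all A, e => ∀ x : Prop, A.Holds (consVal x e)
  | .ex A, e => ∃ x : Prop, A.Holds (consVal x e)

namespace Proposition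

theorem holds_subst (P : Proposition L.logicClosure) (s : ℕ → L.logicClosure.Term ℕ)
    (e : ℕ → Prop) : (P.subst s).Holds e ↔ P.Holds fun n => (s n).realize e := by
  simp only [Holds, subst, FirstOrder.Language.Term.realize_subst]

theorem holds_and (P Q : Proposition L.logicClosure) (e : ℕ → Prop) :
    (and P Q).Holds e ↔ P.Holds e ∧ Q.Holds e := by
  simp only [Holds, and, PropSymbol.eval, Fin.append_left, Fin.append_right]

theorem holds_or (P Q : Proposition L.logicClosure) (e : ℕ → Prop) :
    (or P Q).Holds e ↔ P.Holds e ∨ Q.Holds e := by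
  simp only [Holds, or, PropSymbol.eval, Fin.append_left, Fin.append_right]

/-- No clause of `Entails` singles out a symbol of the original language, so reading these as false
is harmless. For the clauses on `I`, both sides compute to the same truth value. -/
theorem Entails.holds {P Q : Proposition L.logicClosure} (h : Entails P Q) (e : ℕ → Prop) :
    P.Holds e → Q.Holds e := by
  induction h with
  | refl P => exact fun h => h
  | trans _ _ ih ih' => exact fun h => ih' (ih h)
  | le_top P => exact fun _ => trivial
  | bot_le P => exact fun h => h.elim
  | le_and _ _ ih ih' => exact fun h => (holds_and _ _ _).2 ⟨ih h, ih' h⟩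
  | le_or_left _ ih => exact fun h => (holds_or _ _ _).2 (Or.inl (ih h))
  | le_or_right _ ih => exact fun h => (holds_or _ _ _).2 (Or.inr (ih h))
  | and_le_left _ ih => exact fun h => ih ((holds_and _ _ _).1 h).1
  | and_le_right _ ih => exact fun h => ih ((holds_and _ _ _).1 h).2
  | or_le _ _ ih ih' => exact fun h => ((holds_or _ _ _).1 h).elim ih ih'
  | top_le_ofTerm => exact fun _ => trivial
  | ofTerm_le_bot => exact fun h => h
  | ofTerm_and t t' => exact fun h => (holds_and _ _ _).2 h
  | and_ofTerm t t' => exact fun h => (holds_and _ _ _).1 h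
  | ofTerm_or t t' => exact fun h => (holds_or _ _ _).2 h
  | or_ofTerm t t' => exact fun h => (holds_or _ _ _).1 h

end Proposition

namespace QFormula

theorem holds_subst (A : QFormula L.logicClosure) : ∀ (s : ℕ → L.logicClosure.Term ℕ)
    (e : ℕ → Prop), (A.subst s).Holds e ↔ A.Holds fun n => (s n).realize e := by
  -- Evaluation commutes with passing under a binder: variable `0` keeps the new value and the other
  -- terms, being shifted, do not see it.
  have lift : ∀ (s : ℕ → L.logicClosure.Term ℕ) (x : Prop) (e : ℕ → Prop),
      (fun n => (liftSubst s n).realize (consVal x e)) =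
        consVal x fun n => (s n).realize e := by
    intro s x e
    funext n
    cases n with
    | zero => rfl
    | succ n => exact FirstOrder.Language.Term.realize_relabel
  induction A with
  | atom P => exact P.holds_subst
  | all A ih =>
    intro s e
    exact forall_congr' fun x => by rw [ih, lift]
  | ex A ih =>
    intro s e
    exact exists_congr fun x => by rw [ih, lift]

theorem holds_inst (A : QFormula L.logicClosure) (t : L.logicClosure.Term ℕ) (e : ℕ → Prop) :
    (A.inst t).Holds e ↔ A.Holds (consVal (t.realize e) e) := by
  rw [inst, holds_subst]
  refine iff_of_eq (congrArg A.Holds (funext fun n => ?_))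
  cases n <;> rfl

theorem holds_shift (A : QFormula L.logicClosure) (x : Prop) (e : ℕ → Prop) :
    A.shift.Holds (consVal x e) ↔ A.Holds e := by
  rw [shift, holds_subst]
  rfl

end QFormula

/-- Soundness is stated for all valuations because `allR` and `exL` change the value of variable
`0`. Cut is just composition of implications, so no cut elimination is needed. -/
theorem SeqProof.holds {A B : QFormula L.logicClosure} (π : SeqProof (standardAx L) A B) :
    ∀ e : ℕ → Prop, A.Holds e → B.Holds e := by
  induction π with
  | allL t π ih => exact fun e h => ih e ((QFormula.holds_inst _ _ _).2 (h _))
  | allR π ih => exact fun e h x => ih _ ((QFormula.holds_shift _ _ _).2 h)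
  | exL π ih => exact fun e ⟨x, h⟩ => (QFormula.holds_shift _ _ _).1 (ih _ h)
  | exR t π ih => exact fun e h => ⟨_, (QFormula.holds_inst _ _ _).1 (ih e h)⟩
  | ax h => exact fun e => Proposition.Entails.holds h e
  | cut π π' ih ih' => exact fun e h => ih' e (ih e h)

theorem isEmpty_seqProof_top_bot :
    IsEmpty (SeqProof (standardAx L) (.atom Proposition.top) (.atom Proposition.bot)) :=
  ⟨fun π => π.holds (fun _ => False) trivial⟩

end

/-! ## Prenex formulas with given quantifiers -/

namespace QFormula

variable {L : FirstOrder.Language.{u, v}}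

/-- The number of quantifiers of a formula. -/
def size : QFormula L → ℕ
  | .atom _ => 0
  | .all A => A.size + 1
  | .ex A => A.size + 1

/-- The proposition below the quantifiers of a formula. -/
def matrix : QFormula L → Proposition L
  | .atom P => P
  | .all A => A.matrix
  | .ex A => A.matrix

theorem size_subst (A : QFormula L) : ∀ s : ℕ → L.Term ℕ, (A.subst s).size = A.size := by
  induction A with
  | atom P => intro s; rfl
  | all A ih => intro s; exact congrArg Nat.succ (ih _)
  | ex A ih => intro s; exact congrArg Nat.succ (ih _)

/-- The substitution reaching the matrix is lifted once per quantifier. Its exact form is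
irrelevant: axioms are closed under every substitution. -/
theorem exists_matrix_subst (A : QFormula L) : ∀ s : ℕ → L.Term ℕ,
    ∃ s', (A.subst s).matrix = A.matrix.subst s' := by
  induction A with
  | atom P => exact fun s => ⟨s, rfl⟩
  | all A ih => exact fun s => ih _
  | ex A ih => exact fun s => ih _

theorem depth_lt_size : ∀ (A : QFormula L) (m : A.interp.Move), A.depth m < A.size
  | .atom _, m => Empty.elim m
  | .all _, .inl _ => Nat.succ_pos _
  | .all A, .inr m => Nat.succ_lt_succ (A.depth_lt_size m)
  | .ex _, .inl _ => Nat.succ_pos _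
  | .ex A, .inr m => Nat.succ_lt_succ (A.depth_lt_size m)

theorem exists_depth_eq : ∀ (A : QFormula L) (k : ℕ), k < A.size → ∃ m, A.depth m = k
  | .atom _, _, h => absurd h (Nat.not_lt_zero _)
  | .all _, 0, _ => ⟨.inl (), rfl⟩
  | .all A, k + 1, h =>
    let ⟨m, hm⟩ := A.exists_depth_eq k (Nat.lt_of_succ_lt_succ h)
    ⟨.inr m, congrArg Nat.succ hm⟩
  | .ex _, 0, _ => ⟨.inl (), rfl⟩
  | .ex A, k + 1, h =>
    let ⟨m, hm⟩ := A.exists_depth_eq k (Nat.lt_of_succ_lt_succ h)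
    ⟨.inr m, congrArg Nat.succ hm⟩

theorem le_total : ∀ (A : QFormula L) (m n : A.interp.Move), m ≤ n ∨ n ≤ m
  | .atom _, m, _ => Empty.elim m
  | .all _, .inl _, .inl _ => Or.inl le_rfl
  | .all _, .inl _, .inr _ => Or.inl (.sep _ _)
  | .all _, .inr _, .inl _ => Or.inr (.sep _ _)
  | .all A, .inr m, .inr n => (A.le_total m n).imp .inr .inr
  | .ex _, .inl _, .inl _ => Or.inl le_rfl
  | .ex _, .inl _, .inr _ => Or.inl (.sep _ _)
  | .ex _, .inr _, .inl _ => Or.inr (.sep _ _)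
  | .ex A, .inr m, .inr n => (A.le_total m n).imp .inr .inr

/-- Causality of an interpreted formula is total, so strict monotonicity of the depth also reflects
the order. Moves can thus be handled as positions. -/
theorem depth_le_depth (A : QFormula L) (m n : A.interp.Move) :
    A.depth m ≤ A.depth n ↔ m ≤ n := by
  constructor
  · intro h
    rcases A.le_total m n with h' | h'
    · exact h'
    · rcases A.depth_mono n m h' with rfl | h'
      · exact le_rfl
      · exact absurd h h'.not_ge
  · intro h
    rcases A.depth_mono m n h with rfl | h
    · exact le_rfl
    · exact h.le

theorem depth_injective (A : QFormula L) : A.depth.Injective := fun m n h =>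
  le_antisymm ((A.depth_le_depth m n).1 h.le) ((A.depth_le_depth n m).1 h.ge)

/-- The formula with a given matrix and a quantifier for each polarity of a list. -/
def prenex (P : Proposition L) : List ℤˣ → QFormula L
  | [] => .atom P
  | a :: l => if a = 1 then .ex (prenex P l) else .all (prenex P l)

theorem size_prenex (P : Proposition L) (l : List ℤˣ) : (prenex P l).size = l.length := by
  induction l with
  | nil => rfl
  | cons a l ih => rw [prenex]; split <;> simp [size, ih]

theorem matrix_prenex (P : Proposition L) (l : List ℤˣ) : (prenex P l).matrix = P := by
  induction l with
  | nil => rfl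
  | cons a l ih => rw [prenex]; split <;> simp [matrix, ih]

theorem polAt_prenex (P : Proposition L) (l : List ℤˣ) : ∀ k, (prenex P l).polAt k = l[k]? := by
  induction l with
  | nil => intro k; rfl
  | cons a l ih =>
    intro k
    rw [prenex]
    rcases Int.units_eq_one_or a with rfl | rfl <;> cases k <;> simp [polAt, ih]

/-- Every finite filiform game is the interpretation of a formula, whose matrix can be
prescribed in terms of the number of its quantifiers. -/
theorem exists_iso_interp (P : ℕ → Proposition L) {A : Game.{w}} (hA : A.FiniteFiliform) :
    ∃ F : QFormula L, F.matrix = P F.size ∧ Nonempty (Game.Iso F.interp A) := by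
  classical
  have := hA.finite
  let _ := Fintype.ofFinite A.Move
  let _ : LinearOrder A.Move :=
    { Game.order A with
      le_total := hA.total
      toDecidableLE := Classical.decRel _ }
  -- The moves listed in causal order; their polarities, read in this order, are the quantifier
  -- prefix.
  let e : Fin (Fintype.card A.Move) ≃o A.Move := Fintype.orderIsoFinOfCardEq A.Move rfl
  let l : List ℤˣ := List.ofFn fun k => A.pol (e k)
  let F := prenex (P (Fintype.card A.Move)) l
  have hF : F.size = Fintype.card A.Move := (size_prenex _ _).trans List.length_ofFn
  let f : F.interp.Move → Fin (Fintype.card A.Move) := fun m => ⟨F.depth m, (F.depth_lt_size m).trans_eq hF⟩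
  have hf : f.Bijective := by
    constructor
    · exact fun m n h => F.depth_injective (congrArg Fin.val h)
    · intro k
      obtain ⟨m, hm⟩ := F.exists_depth_eq k (k.2.trans_eq hF.symm)
      exact ⟨m, Fin.ext hm⟩
  refine ⟨F, by rw [hF]; exact matrix_prenex _ _, ⟨⟨(Equiv.ofBijective f hf).trans e.toEquiv,
    fun m n => ?_, fun m => ?_⟩⟩⟩
  · exact (e.le_iff_le (x := f m) (y := f n)).trans (F.depth_le_depth m n)
  · have h := F.polAt_depth m
    rw [polAt_prenex, List.getElem?_eq_getElem (by rw [List.length_ofFn]; exact (f m).2)] at h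
    rw [← Option.some.inj h]
    exact (List.getElem_ofFn (f := fun k => A.pol (e k)) _).symm

end QFormula

/-! ## Definability -/

namespace SeqProof

variable {L : FirstOrder.Language.{u, v}}

/-- A relation `R` on the quantifiers of a sequent `F ⊢ G` such that neither the order of the
quantifiers on each side nor the relation itself creates a cycle is the justification relation of a
cut-free proof, if the matrix of `G` is a consequence of `⊤`. -/
theorem exists_justifies_iff {Ax : Set (Proposition L.logicClosure × Proposition L.logicClosure)}
    (hAx : IsAxiomSet Ax) (hAx' : standardAx L ⊆ Ax) (R : Position → Position → Prop)
    (hll : ∀ i k, i ≤ k → ¬ R (.inl k) (.inl i)) (hrr : ∀ j k, j ≤ k → ¬ R (.inr k) (.inr j))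
    (hlr : ∀ i j k k', i ≤ k → j ≤ k' → R (.inl k) (.inr j) → ¬ R (.inr k') (.inl i)) (n : ℕ) :
    ∀ (F G : QFormula L.logicClosure) (i j N : ℕ) (ρ : ℕ → Option Position),
      F.size + G.size = n → (Proposition.top, G.matrix) ∈ Ax → (∀ x, N ≤ x → ρ x = none) →
      (∀ p q, R p q → seqPol F G i j q = some 1 →
        (∃ x, ρ x = some p) ∨ seqPol F G i j p = some (-1)) →
      ∃ (π : SeqProof Ax F G) (h : π.CutFree), ∀ p q,
        π.Justifies h i j ρ p q ↔ R p q ∧ seqPol F G i j q = some 1 := by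
  have hmat : ∀ (G : QFormula L.logicClosure) s, (Proposition.top, G.matrix) ∈ Ax →
      (Proposition.top, (G.subst s).matrix) ∈ Ax := by
    intro G s h
    obtain ⟨s', e⟩ := G.exists_matrix_subst s
    have := hAx.subst _ _ s' h
    rwa [Proposition.subst_top, ← e] at this
  have hwit : ∀ (N : ℕ) (ρ : ℕ → Option Position) (q : Position), (∀ x, N ≤ x → ρ x = none) →
      (∀ p, R p q → ∃ x, ρ x = some p) → ∃ t : L.logicClosure.Term ℕ,
        ∀ p, (∃ x ∈ t.varFinset, ρ x = some p) ↔ R p q := by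
    classical
    intro N ρ q hN hq
    -- The witness collects the variables in scope whose quantifier is `R`-related to `q`. The bound
    -- `N` on the variables recorded by `ρ` makes this a finite list.
    refine ⟨LogicTerm.joinVars ((List.range N).filter fun x => ∃ p, ρ x = some p ∧ R p q),
      fun p => ⟨?_, fun h => ?_⟩⟩
    · rintro ⟨x, hx, h⟩
      rw [LogicTerm.varFinset_joinVars] at hx
      simp only [List.mem_toFinset, List.mem_filter, decide_eq_true_eq] at hx
      obtain ⟨-, p', h', hR⟩ := hx
      rw [h] at h'
      exact Option.some.inj h' ▸ hR
    · obtain ⟨x, hx⟩ := hq p h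
      refine ⟨x, ?_, hx⟩
      rw [LogicTerm.varFinset_joinVars]
      simp only [List.mem_toFinset, List.mem_filter, List.mem_range, decide_eq_true_eq]
      exact ⟨lt_of_not_ge fun h => (by rw [hN x h] at hx; cases hx), p, hx, h⟩
  have hcons : ∀ (N : ℕ) (p : Position) (ρ : ℕ → Option Position), (∀ x, N ≤ x → ρ x = none) →
      ∀ x, N + 1 ≤ x → consPos p ρ x = none := by
    rintro N p ρ h (_ | x) hx
    · exact absurd hx (Nat.not_succ_le_zero N)
    · exact h x (Nat.le_of_succ_le_succ hx)
  have hneg : ((-1 : ℤˣ) = 1) = False := by decide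
  -- Induction on the number of quantifiers not yet introduced. The last hypothesis is the invariant
  -- of the search: whatever justifies a pending Proponent quantifier is either in scope already or
  -- a pending Opponent quantifier.
  induction n with
  | zero =>
    intro F G i j N ρ hn hG hN hR
    obtain ⟨hF0, hG0⟩ := Nat.add_eq_zero_iff.1 hn
    cases F with
    | atom P =>
      cases G with
      | atom Q =>
        refine ⟨.ax (hAx.trans _ _ _ (hAx' (Proposition.Entails.le_top P)) hG), trivial,
          fun p q => ⟨False.elim, ?_⟩⟩
        rintro ⟨-, h⟩
        rcases q with q | q <;> simp [seqPol, QFormula.polAt] at h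
      | all G => cases hG0
      | ex G => cases hG0
    | all F => cases hF0
    | ex F => cases hF0
  | succ n ih =>
    have rule_exL : ∀ (F G : QFormula L.logicClosure) (i j N : ℕ) (ρ : ℕ → Option Position),
        F.ex.size + G.size = n + 1 → (Proposition.top, G.matrix) ∈ Ax →
        (∀ x, N ≤ x → ρ x = none) →
        (∀ p q, R p q → seqPol F.ex G i j q = some 1 →
          (∃ x, ρ x = some p) ∨ seqPol F.ex G i j p = some (-1)) →
        ∃ (π : SeqProof Ax F.ex G) (h : π.CutFree), ∀ p q,
          π.Justifies h i j ρ p q ↔ R p q ∧ seqPol F.ex G i j q = some 1 := by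
      intro F G i j N ρ hn hG hN hR
      -- The quantifier introduced is an Opponent move, so the pending Proponent moves are
      -- unchanged.
      have hq : ∀ q, seqPol F.ex G i j q = some 1 ↔ seqPol F G.shift (i + 1) j q = some 1 := by
        intro q
        rw [seqPol_exL]
        split
        · next h => subst h; rw [seqPol_inl_succ]; simp [hneg]
        · rfl
      obtain ⟨π, h, hπ⟩ := ih F G.shift (i + 1) j (N + 1) (consPos (.inl i) ρ)
        (by rw [QFormula.shift, QFormula.size_subst]; simp only [QFormula.size] at hn; omega)
        (hmat _ _ hG) (hcons _ _ _ hN) (by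
          intro p q hpq hq'
          rw [consPos_eq]
          rcases hR p q hpq ((hq q).2 hq') with h | h
          · exact Or.inl (Or.inr h)
          · rw [seqPol_exL] at h
            split at h
            · next e => exact Or.inl (Or.inl e.symm)
            · exact Or.inr h)
      exact ⟨.exL π, h, fun p q => (hπ p q).trans (by rw [hq])⟩
    have rule_allR : ∀ (F G : QFormula L.logicClosure) (i j N : ℕ) (ρ : ℕ → Option Position),
        F.size + G.all.size = n + 1 → (Proposition.top, G.matrix) ∈ Ax →
        (∀ x, N ≤ x → ρ x = none) →
        (∀ p q, R p q → seqPol F G.all i j q = some 1 →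
          (∃ x, ρ x = some p) ∨ seqPol F G.all i j p = some (-1)) →
        ∃ (π : SeqProof Ax F G.all) (h : π.CutFree), ∀ p q,
          π.Justifies h i j ρ p q ↔ R p q ∧ seqPol F G.all i j q = some 1 := by
      intro F G i j N ρ hn hG hN hR
      have hq : ∀ q, seqPol F G.all i j q = some 1 ↔ seqPol F.shift G i (j + 1) q = some 1 := by
        intro q
        rw [seqPol_allR]
        split
        · next h => subst h; rw [seqPol_inr_succ]; simp [hneg]
        · rfl
      obtain ⟨π, h, hπ⟩ := ih F.shift G i (j + 1) (N + 1) (consPos (.inr j) ρ)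
        (by rw [QFormula.shift, QFormula.size_subst]; simp only [QFormula.size] at hn; omega)
        hG (hcons _ _ _ hN) (by
          intro p q hpq hq'
          rw [consPos_eq]
          rcases hR p q hpq ((hq q).2 hq') with h | h
          · exact Or.inl (Or.inr h)
          · rw [seqPol_allR] at h
            split at h
            · next e => exact Or.inl (Or.inl e.symm)
            · exact Or.inr h)
      exact ⟨.allR π, h, fun p q => (hπ p q).trans (by rw [hq])⟩
    have rule_allL : ∀ (F G : QFormula L.logicClosure) (i j N : ℕ) (ρ : ℕ → Option Position),
        F.all.size + G.size = n + 1 → (Proposition.top, G.matrix) ∈ Ax →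
        (∀ x, N ≤ x → ρ x = none) →
        (∀ p q, R p q → seqPol F.all G i j q = some 1 →
          (∃ x, ρ x = some p) ∨ seqPol F.all G i j p = some (-1)) →
        (∀ p, R p (.inl i) → ∃ x, ρ x = some p) →
        ∃ (π : SeqProof Ax F.all G) (h : π.CutFree), ∀ p q,
          π.Justifies h i j ρ p q ↔ R p q ∧ seqPol F.all G i j q = some 1 := by
      intro F G i j N ρ hn hG hN hR hi
      obtain ⟨t, ht⟩ := hwit N ρ (.inl i) hN hi
      -- The pending Proponent moves lose exactly the quantifier introduced, whose justifiers are
      -- the variables of `t`; the other justifications come from the premise.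
      have hq : ∀ q, seqPol F.all G i j q = some 1 ↔
          q = .inl i ∨ seqPol (F.inst t) G (i + 1) j q = some 1 := by
        intro q
        have e : seqPol F.all G i j q =
          if q = .inl i then some 1 else seqPol (F.inst t) G (i + 1) j q := seqPol_allL F G _ i j q
        rw [e]
        split <;> simp [*]
      obtain ⟨π, h, hπ⟩ := ih (F.inst t) G (i + 1) j N ρ
        (by rw [QFormula.inst, QFormula.size_subst]; simp only [QFormula.size] at hn; omega)
        hG hN (by
          intro p q hpq hq'
          rcases hR p q hpq ((hq q).2 (Or.inr hq')) with h | h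
          · exact Or.inl h
          · rw [seqPol_allL] at h
            split at h
            · exact absurd (Option.some.inj h) (by decide)
            · exact Or.inr h)
      refine ⟨.allL t π, h, fun p q => (or_congr Iff.rfl (hπ p q)).trans ?_⟩
      rw [hq, ht]
      constructor
      · rintro (⟨rfl, h⟩ | ⟨h, h'⟩)
        · exact ⟨h, Or.inl rfl⟩
        · exact ⟨h, Or.inr h'⟩
      · rintro ⟨h, rfl | h'⟩
        · exact Or.inl ⟨rfl, h⟩
        · exact Or.inr ⟨h, h'⟩
    have rule_exR : ∀ (F G : QFormula L.logicClosure) (i j N : ℕ) (ρ : ℕ → Option Position),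
        F.size + G.ex.size = n + 1 → (Proposition.top, G.matrix) ∈ Ax →
        (∀ x, N ≤ x → ρ x = none) →
        (∀ p q, R p q → seqPol F G.ex i j q = some 1 →
          (∃ x, ρ x = some p) ∨ seqPol F G.ex i j p = some (-1)) →
        (∀ p, R p (.inr j) → ∃ x, ρ x = some p) →
        ∃ (π : SeqProof Ax F G.ex) (h : π.CutFree), ∀ p q,
          π.Justifies h i j ρ p q ↔ R p q ∧ seqPol F G.ex i j q = some 1 := by
      intro F G i j N ρ hn hG hN hR hj
      obtain ⟨t, ht⟩ := hwit N ρ (.inr j) hN hj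
      have hq : ∀ q, seqPol F G.ex i j q = some 1 ↔
          q = .inr j ∨ seqPol F (G.inst t) i (j + 1) q = some 1 := by
        intro q
        have e : seqPol F G.ex i j q =
          if q = .inr j then some 1 else seqPol F (G.inst t) i (j + 1) q := seqPol_exR F G _ i j q
        rw [e]
        split <;> simp [*]
      obtain ⟨π, h, hπ⟩ := ih F (G.inst t) i (j + 1) N ρ
        (by rw [QFormula.inst, QFormula.size_subst]; simp only [QFormula.size] at hn; omega)
        (hmat _ _ hG) hN (by
          intro p q hpq hq'
          rcases hR p q hpq ((hq q).2 (Or.inr hq')) with h | h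
          · exact Or.inl h
          · rw [seqPol_exR] at h
            split at h
            · exact absurd (Option.some.inj h) (by decide)
            · exact Or.inr h)
      refine ⟨.exR t π, h, fun p q => (or_congr Iff.rfl (hπ p q)).trans ?_⟩
      rw [hq, ht]
      constructor
      · rintro (⟨rfl, h⟩ | ⟨h, h'⟩)
        · exact ⟨h, Or.inl rfl⟩
        · exact ⟨h, Or.inr h'⟩
      · rintro ⟨h, rfl | h'⟩
        · exact Or.inl ⟨rfl, h⟩
        · exact Or.inr ⟨h, h'⟩
    -- a quantifier that cannot be introduced yet is blocked by one on the other side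
    have blocked_left : ∀ (F G : QFormula L.logicClosure) (i j : ℕ) (ρ : ℕ → Option Position),
        (∀ p q, R p q → seqPol F.all G i j q = some 1 →
          (∃ x, ρ x = some p) ∨ seqPol F.all G i j p = some (-1)) →
        (¬ ∀ p, R p (.inl i) → ∃ x, ρ x = some p) →
        ∃ k, j ≤ k ∧ G.polAt (k - j) = some (-1) ∧ R (.inr k) (.inl i) := by
      intro F G i j ρ hR h
      push Not at h
      obtain ⟨p, hp, hρ⟩ := h
      rcases hR p _ hp (by rw [seqPol_allL _ _ FirstOrder.Language.Term.var, if_pos rfl])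
        with ⟨x, hx⟩ | h
      · exact absurd hx (hρ x)
      · rcases p with k | k <;> simp only [seqPol] at h <;> split at h
        -- A pending justifier on the same side would lie at or inside the quantifier that it
        -- justifies.
        · next hk => exact absurd hp (hll i k hk)
        · cases h
        · next hk => exact ⟨k, hk, h, hp⟩
        · cases h
    have blocked_right : ∀ (F G : QFormula L.logicClosure) (i j : ℕ) (ρ : ℕ → Option Position),
        (∀ p q, R p q → seqPol F G.ex i j q = some 1 →
          (∃ x, ρ x = some p) ∨ seqPol F G.ex i j p = some (-1)) →
        (¬ ∀ p, R p (.inr j) → ∃ x, ρ x = some p) →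
        ∃ k, i ≤ k ∧ (F.polAt (k - i)).map Neg.neg = some (-1) ∧ R (.inl k) (.inr j) := by
      intro F G i j ρ hR h
      push Not at h
      obtain ⟨p, hp, hρ⟩ := h
      rcases hR p _ hp (by rw [seqPol_exR _ _ FirstOrder.Language.Term.var, if_pos rfl])
        with ⟨x, hx⟩ | h
      · exact absurd hx (hρ x)
      · rcases p with k | k <;> simp only [seqPol] at h <;> split at h
        · next hk => exact ⟨k, hk, h, hp⟩
        · cases h
        · next hk => exact absurd hp (hrr j k hk)
        · cases h
    intro F G i j N ρ hn hG hN hR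
    cases F with
    | ex F => exact rule_exL F G i j N ρ hn hG hN hR
    | atom P =>
      cases G with
      | atom Q => cases hn
      | all G => exact rule_allR _ G i j N ρ hn hG hN hR
      | ex G =>
        refine rule_exR _ G i j N ρ hn hG hN hR (by_contra fun h => ?_)
        obtain ⟨k, -, h, -⟩ := blocked_right _ G i j ρ hR h
        cases h
    | all F =>
      cases G with
      | atom Q =>
        refine rule_allL F _ i j N ρ hn hG hN hR (by_contra fun h => ?_)
        obtain ⟨k, -, h, -⟩ := blocked_left F _ i j ρ hR h
        cases h
      | all G => exact rule_allR _ G i j N ρ hn hG hN hR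
      | ex G =>
        by_cases hi : ∀ p, R p (.inl i) → ∃ x, ρ x = some p
        · exact rule_allL F _ i j N ρ hn hG hN hR hi
        -- If both heads were blocked, then `k` on the right would justify the head `i`, and `k'` on
        -- the left the head `j`, with `i ≤ k'` and `j ≤ k`: the crossed configuration excluded by
        -- `hlr`.
        · refine rule_exR _ G i j N ρ hn hG hN hR (by_contra fun hj => ?_)
          obtain ⟨k, hk, -, h⟩ := blocked_left F _ i j ρ hR hi
          obtain ⟨k', hk', -, h'⟩ := blocked_right _ G i j ρ hR hj
          exact hlr i j k' k hk' hk h' h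

end SeqProof

/-- Acyclic cyclic strategies between finite filiform games are definable. -/
theorem CyclicStrategy.Acyclic.definable {L : FirstOrder.Language.{u, v}}
    {Ax : Set (Proposition L.logicClosure × Proposition L.logicClosure)}
    (hAx : IsAxiomSet Ax) (hAx' : standardAx L ⊆ Ax) {A B : Game.{w}}
    (hA : A.FiniteFiliform) (hB : B.FiniteFiliform) {σ : CyclicStrategy (A.arrow B)}
    (hσ : σ.Acyclic) : Definable Ax σ := by
  -- With `n` quantifiers in front, the variables below `n` are exactly the bound ones, so the
  -- formulas built are closed.
  let P : ℕ → Proposition L.logicClosure := fun n =>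
    Proposition.ofTerm (LogicTerm.joinVars (List.range n))
  obtain ⟨F, -, ⟨e⟩⟩ := QFormula.exists_iso_interp P hA
  obtain ⟨G, hG, ⟨e'⟩⟩ := QFormula.exists_iso_interp P hB
  let f : (F.interp.arrow G.interp).Move → (A.arrow B).Move := Sum.map e.toEquiv e'.toEquiv
  have hf : f.Injective := e.toEquiv.injective.sumMap e'.toEquiv.injective
  have hpol : ∀ m, (A.arrow B).pol (f m) = (F.interp.arrow G.interp).pol m := by
    rintro (m | m)
    · exact congrArg Neg.neg (e.pol_eq m)
    · exact e'.pol_eq m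
  let g := SeqProof.movePos F G
  have hg : g.Injective := F.depth_injective.sumMap G.depth_injective
  -- The diagonal is removed because a strategy is reflexive while justification never relates a
  -- quantifier to itself.
  let R : Position → Position → Prop := Relation.Map (fun m n => m ≠ n ∧ σ.rel (f m) (f n)) g g
  have hRl : ∀ i k, i ≤ k → ¬ R (.inl k) (.inl i) := by
    rintro i k hik ⟨m | m, n | n, ⟨hne, hmn⟩, hm, hn⟩ <;> cases hm <;> cases hn
    have h := (e.le_iff _ _).2 ((F.depth_le_depth n m).1 hik)
    exact hne (hf (hσ _ _ (.single (Or.inr hmn)) (.single (Or.inl (Sum.inl_le_inl_iff.2 h)))))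
  have hRr : ∀ i k, i ≤ k → ¬ R (.inr k) (.inr i) := by
    rintro i k hik ⟨m | m, n | n, ⟨hne, hmn⟩, hm, hn⟩ <;> cases hm <;> cases hn
    have h := (e'.le_iff _ _).2 ((G.depth_le_depth n m).1 hik)
    exact hne (hf (hσ _ _ (.single (Or.inr hmn)) (.single (Or.inl (Sum.inr_le_inr_iff.2 h)))))
  have hRlr : ∀ i j k k', i ≤ k → j ≤ k' → R (.inl k) (.inr j) → ¬ R (.inr k') (.inl i) := by
    rintro i j k k' hik hjk ⟨m | m, n | n, ⟨hne, hmn⟩, hm, hn⟩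
      ⟨n' | n', m' | m', ⟨-, hnm⟩, hn', hm'⟩ <;>
      cases hm <;> cases hn <;> cases hm' <;> cases hn'
    have h := (e.le_iff _ _).2 ((F.depth_le_depth m' m).1 hik)
    have h' := (e'.le_iff _ _).2 ((G.depth_le_depth n n').1 hjk)
    -- The cycle alternates between σ and causality: from `m` by σ to `n`, up to `n'`, by σ to `m'`,
    -- and up to `m`.
    refine hne (hf (hσ _ _ (.single (Or.inr hmn)) ?_))
    exact .tail (.tail (.single (Or.inl (Sum.inr_le_inr_iff.2 h'))) (Or.inr hnm))
      (Or.inl (Sum.inl_le_inl_iff.2 h))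
  -- The search starts with no variable in scope, so the invariant says that every justifier is an
  -- Opponent move: the polarity condition on σ.
  obtain ⟨π, h, hπ⟩ := SeqProof.exists_justifies_iff hAx hAx' R hRl hRr hRlr _ F G 0 0 0
    (fun _ => none) rfl (hG ▸ hAx' (Proposition.Entails.top_le_ofTerm_joinVars _))
    (fun _ _ => rfl) (by
      rintro _ _ ⟨m, n, ⟨hne, hmn⟩, rfl, rfl⟩ -
      exact Or.inr ((SeqProof.seqPol_movePos F G m).trans
        (congrArg some ((hpol m).symm.trans (σ.polarity _ _ hmn (hf.ne hne)).1))))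
  refine ⟨F, G, e, e', π, h, fun m n => ?_⟩
  change m = n ∨ π.Justifies h 0 0 (fun _ => none) (g m) (g n) ↔ σ.rel (f m) (f n)
  rw [hπ]
  constructor
  · rintro (rfl | ⟨⟨m', n', ⟨-, h⟩, hm, hn⟩, -⟩)
    · exact σ.refl _
    · rwa [hg hm, hg hn] at h
  · intro hmn
    by_cases hne : m = n
    · exact Or.inl hne
    · exact Or.inr ⟨⟨m, n, ⟨hne, hmn⟩, rfl, rfl⟩, (SeqProof.seqPol_movePos F G n).trans
        (congrArg some ((hpol n).symm.trans (σ.polarity _ _ hmn (hf.ne hne)).2))⟩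

theorem mainTheorem5 (L : FirstOrder.Language.{u, v}) :
    IsAxiomSet (standardAx L) ∧
    IsEmpty (SeqProof (standardAx L) (.atom Proposition.top) (.atom Proposition.bot)) ∧
    ∀ Ax : Set (Proposition L.logicClosure × Proposition L.logicClosure),
      IsAxiomSet Ax → standardAx L ⊆ Ax →
      ∀ (A B : Game.{w}) (σ : CyclicStrategy (A.arrow B)), GamesHom σ → Definable Ax σ :=
  ⟨isAxiomSet_standardAx, isEmpty_seqProof_top_bot, fun _ hAx hAx' _ _ _ hσ =>
    have h := hσ.finiteFiliform_and_acyclic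
    h.2.2.definable hAx hAx' h.1 h.2.1⟩
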